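/- **Proposition 3.9 (sprinkled decoupling for Kostlan's ensemble).** For $n\ge 1$ let $$f_n(x)=\sum_{|J|=n}\sqrt{\binom{n}{J}}\,a_J x^J,\qquad x\in\mathcal S^2\subset\mathbb R^3,$$ where $J=(j_0,j_1,j_2)$ ranges over multi-indices in $\mathbb Z_{\ge 0}^3$ with $|J|=j_0+j_1+j_2=n$, $\binom nJ=\frac{n!}{j_0!\,j_1!\,j_2!}$, $x^J=x_0^{j_0}x_1^{j_1}x_2^{j_2}$, and the $a_J$ are i.i.d. standard Gaussian random variables (Kostlan's ensemble). Let $d(x,y)=\arccos\langle x,y\rangle$ be the spherical distance, let $\mathcal O=\{x\in\mathbb R^3:x_i>0\text{ for all }i\}$ be the open positive orthant, and call $\{y\in\mathcal S^2: d(x,y)\le u\}$ the spherical cap of radius $u$ centred at $x\in\mathcal S^2$. For $\mathcal U\subseteq\mathcal S^2$ and $r,u\in[0,\pi]$, a finite collection $(A_i)_{i\le k}$ of sets of continuous functions on $\mathcal S^2$ is said to be in class $E(\mathcal U,r,u)$ if * for each $i$ there is a compact set $U_i\subseteq\mathcal U$, contained in some spherical cap of radius $u$, such that $A_i$ belongs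 to the $\sigma$-algebra generated by the restriction map $g\mapsto g|_{U_i}$ (that is, by the evaluations $g\mapsto g(x)$, $x\in U_i$), and $d(x,y)\ge r$ for all $x\in U_i$, $y\in U_j$, $i\ne j$; * each $A_i$ is increasing: if $g\in A_i$ and $h$ is a continuous function on $\mathcal S^2$ with $h\ge g$ pointwise, then $h\in A_i$. Then for every compact $\mathcal U\subseteq\mathcal S^2\cap\mathcal O$ there exist constants $c_1,c_2>0$ such that for all $n\ge1$, all $r,u\in[0,\pi]$ with $r\ge n^{-1/2}$ and $u\ge n^{-1/2}$, all $k$, every collection $(A_i)_{i\le k}$ in class $E(\mathcal U,r,u)$, and all $$t\ \ge\ c_1\sqrt{\log(2u\sqrt n)}\;e^{-c_2r^2n},$$ both of the following inequalities hold: $$\mathbb P\Big[\bigcap_{i\le k}\{f_n\in A_i\}\Big]\le\prod_{i\le k}\mathbb P\big[f_n+t\in A_i\big]+c_1k\,e^{-c_2t^2e^{c_2r^2n}},$$ $$\mathbb P\Big[\bigcap_{i\le k}\{f_n\in A_i\}\Big]\le\Big(c_1\sup_{i\le k}\mathbb P\big[f_n+t\in A_i\big]\Big)^{c_2k}+c_1\,e^{-c_2k\,t^2e^{c_2r^2n}}.$$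 -/

import Mathlib

open MeasureTheory ProbabilityTheory

/-- The unit sphere `S²` in Euclidean `ℝ³`. -/
abbrev S2 : Type := Metric.sphere (0 : EuclideanSpace ℝ (Fin 3)) 1

/-- The spherical (geodesic) distance on `S²`, i.e. the angle `arccos ⟪x, y⟫`. -/
noncomputable def sphDist (x y : S2) : ℝ :=
  InnerProductGeometry.angle (x : EuclideanSpace ℝ (Fin 3)) (y : EuclideanSpace ℝ (Fin 3))

/-- The closed spherical cap of radius `u` centred at `x`. -/
def sphCap (x : S2) (u : ℝ) : Set S2 := {y | sphDist x y ≤ u}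

/-- The part of the sphere in the strictly positive orthant. -/
def posOrthant : Set S2 := {x | ∀ i, 0 < (x : EuclideanSpace ℝ (Fin 3)) i}

/-- The random polynomial `f_n(x) = ∑_{|J| = n} √(n choose J) a_J x^J` with coefficients `a`,
as a continuous function on the sphere. -/
noncomputable def kostlan (n : ℕ) (a : (Fin 3 → ℕ) → ℝ) : C(S2, ℝ) where
  toFun x := ∑ J ∈ Finset.piAntidiag (Finset.univ : Finset (Fin 3)) n,
    √(Nat.multinomial Finset.univ J : ℝ) * a J *
      ∏ i, (x : EuclideanSpace ℝ (Fin 3)) i ^ J i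
  continuous_toFun := by fun_prop

/-- `a` is a family of i.i.d. standard Gaussian random variables. -/
structure IsIIDStdGaussian {Ω ι : Type*} [MeasurableSpace Ω] (μ : Measure Ω)
    (a : ι → Ω → ℝ) : Prop where
  measurable : ∀ J, Measurable (a J)
  law : ∀ J, μ.map (a J) = gaussianReal 0 1
  indep : iIndepFun a μ

/-- The σ-algebra on continuous functions on the sphere that is generated by the restriction
map `g ↦ g|_U`, i.e. by the evaluations at the points of `U`. -/
abbrev restrSigma (U : Set S2) : MeasurableSpace C(S2, ℝ) :=
  MeasurableSpace.comap (fun (g : C(S2, ℝ)) (x : U) => g x) MeasurableSpace.pi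

/-- The class `E(𝒰, r, u)` of collections of `k` events: they are measurable with respect to the
restrictions of the field to compact subsets of `𝒰` that are contained in caps of radius `u` and
are pairwise `r`-separated, and they are increasing for the pointwise order. -/
structure InClassE (𝒰 : Set S2) (r u : ℝ) {k : ℕ} (A : Fin k → Set C(S2, ℝ)) : Prop where
  localized : ∃ U : Fin k → Set S2,
    (∀ i, IsCompact (U i) ∧ U i ⊆ 𝒰 ∧ MeasurableSet[restrSigma (U i)] (A i) ∧
      ∃ x, U i ⊆ sphCap x u) ∧
    ∀ i j, i ≠ j → ∀ x ∈ U i, ∀ y ∈ U j, r ≤ sphDist x y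
  increasing : ∀ i, IsUpperSet (A i)

/-! The terms of `f_n` are independent, and at a point `x` the variance of the term with index `J`
is the multinomial weight of `J` with cell probabilities `x_j²`. So `f_n` near `x` is carried by the
indices with `J/n ≈ x²`, up to fluctuations of order `n^{-1/2}`. In the open orthant `x ↦ x²` keeps
separated points separated. Hence the index sets `N i` of all `J` with `J/n` within a small multiple
of `r` of some `x²`, `x ∈ U i`, are disjoint, and the parts of `f_n` carried by them are exactly
independent.

On `U i` the remaining part has variance of order `exp(-c r² n)`. Let `V i` be an event outside
which it is at most `t/2` on `U i`. By monotonicity, off `V i`, `f_n ∈ A i` implies `f_{N i} + t/2 ∈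
A i`, which implies `f_n + t ∈ A i`. It remains to show that any set `S` of the `V i` occurs jointly
with probability at most `q^|S|`. The first inequality is then a union bound; for the second, either
at least half of the `V i` occur or at least half fail.

The remainders use overlapping indices and are dependent. Their joint exponential moment is bounded
by linearising the squared norms with auxiliary Gaussian vectors and applying Cauchy–Schwarz with
weights `w i J` decaying like a Gaussian in the distance from `J` to the point `x i`
(`lintegral_eexp_sum_sq_le`). The weights sum to at most one because the points are separated
(`exists_packing_bound`), and they cost little because multinomial fluctuations have Gaussian
moments (`sum_multinomialWeight_mul_exp_sq_le`). Suprema reduce to finitely many points: on a ball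
of radius `n^{-1/2}` the remainder is the inner product of one random Hilbert vector with bounded
deterministic vectors (`kostlanPart_eq_inner`), so a net of polynomial size suffices, and the lower
bound on `t` pays for it. -/

/-! ### Exponential moments of Gaussian linear and quadratic forms. -/

/-- The exponential of a real number, with values in `[0, ∞]`. -/
noncomputable def eexp (x : ℝ) : ENNReal := ENNReal.ofReal (Real.exp x)

lemma eexp_zero : eexp 0 = 1 := by simp [eexp]

lemma eexp_add (x y : ℝ) : eexp (x + y) = eexp x * eexp y := by
  rw [eexp, Real.exp_add, ENNReal.ofReal_mul (Real.exp_pos _).le]; rfl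

lemma eexp_sum {ι : Type*} (s : Finset ι) (f : ι → ℝ) :
    eexp (∑ i ∈ s, f i) = ∏ i ∈ s, eexp (f i) := by
  rw [eexp, Real.exp_sum, ENNReal.ofReal_prod_of_nonneg fun _ _ => (Real.exp_pos _).le]; rfl

lemma eexp_le_eexp {x y : ℝ} (h : x ≤ y) : eexp x ≤ eexp y :=
  ENNReal.ofReal_le_ofReal (Real.exp_le_exp.2 h)

lemma measurable_eexp : Measurable eexp :=
  ENNReal.measurable_ofReal.comp Real.measurable_exp

lemma Measurable.eexp {α : Type*} [MeasurableSpace α] {f : α → ℝ} (hf : Measurable f) :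
    Measurable fun x => eexp (f x) := measurable_eexp.comp hf

lemma lintegral_eexp_gaussianReal (c : ℝ) :
    ∫⁻ x, eexp (c * x) ∂gaussianReal 0 1 = eexp (c ^ 2 / 2) := by
  have h := mgf_gaussianReal (p := gaussianReal 0 1) (X := id) (μ := 0) (v := 1) (by simp) c
  unfold eexp
  rw [← ofReal_integral_eq_lintegral_ofReal (integrable_exp_mul_gaussianReal c)
    (Filter.Eventually.of_forall fun _ => (Real.exp_pos _).le)]
  congr 1
  simpa [mgf] using h

lemma lintegral_eexp_sum_of_iid {Ω ι : Type*} [MeasurableSpace Ω] {μ : Measure Ω}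
    {a : ι → Ω → ℝ} (ha : IsIIDStdGaussian μ a) (s : Finset ι) (c : ι → ℝ) :
    ∫⁻ ω, eexp (∑ J ∈ s, c J * a J ω) ∂μ = eexp (∑ J ∈ s, c J ^ 2 / 2) := by
  simp_rw [eexp_sum]
  have hind : iIndepFun (fun J ω => eexp (c J * a J ω)) μ :=
    ha.indep.comp (fun J x => eexp (c J * x)) fun J => (measurable_id.const_mul (c J)).eexp
  rw [lintegral_prod_eq_prod_lintegral_of_indepFun s _ hind
    fun J => ((ha.measurable J).const_mul _).eexp]
  refine Finset.prod_congr rfl fun J _ => ?_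
  rw [← lintegral_eexp_gaussianReal, ← ha.law J,
    lintegral_map (f := fun x => eexp (c J * x)) (measurable_id.const_mul (c J)).eexp
      (ha.measurable J)]

lemma isIIDStdGaussian_pi (ι : Type*) [Fintype ι] :
    IsIIDStdGaussian (Measure.pi fun _ : ι => gaussianReal 0 1) (fun l g => g l) where
  measurable l := measurable_pi_apply l
  law l := (measurePreserving_eval _ l).map_eq
  indep := iIndepFun_pi (X := fun _ => id) fun _ => aemeasurable_id

lemma lintegral_eexp_sq_gaussianReal_le :
    ∫⁻ x, eexp (x ^ 2 / 4) ∂gaussianReal 0 1 ≤ 2 := by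
  rw [gaussianReal_of_var_ne_zero _ one_ne_zero,
    lintegral_withDensity_eq_lintegral_mul _ (measurable_gaussianPDF 0 1) (by
      exact ((measurable_id.pow_const 2).div_const 4).eexp)]
  have h : ∀ x : ℝ, (gaussianPDF 0 1 * fun x => eexp (x ^ 2 / 4)) x =
      ENNReal.ofReal ((√(2 * Real.pi))⁻¹ * Real.exp (-(1 / 4) * x ^ 2)) := by
    intro x
    simp only [Pi.mul_apply, gaussianPDF, gaussianPDFReal, eexp]
    rw [← ENNReal.ofReal_mul (by positivity), mul_assoc, ← Real.exp_add]
    congr 2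
    · simp
    · congr 1; simp; ring
  rw [lintegral_congr h, ← ofReal_integral_eq_lintegral_ofReal
    ((integrable_exp_neg_mul_sq (by norm_num)).const_mul _)
    (Filter.Eventually.of_forall fun _ => by positivity), integral_const_mul, integral_gaussian]
  rw [show (2 : ENNReal) = ENNReal.ofReal 2 by simp]
  refine ENNReal.ofReal_le_ofReal ?_
  rw [inv_mul_le_iff₀ (by positivity), Real.sqrt_le_iff]
  refine ⟨by positivity, ?_⟩
  rw [mul_pow, Real.sq_sqrt (by positivity)]
  nlinarith [Real.pi_pos]

/-- Gaussian linearisation of the exponential of a sum of squares. -/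
lemma eexp_sum_sq_eq_lintegral {ι : Type*} [Fintype ι] {lam : ℝ} (hlam : 0 ≤ lam) (x : ι → ℝ) :
    eexp (lam * ∑ l, x l ^ 2) =
      ∫⁻ g, eexp (∑ l, √(2 * lam) * x l * g l) ∂Measure.pi fun _ : ι => gaussianReal 0 1 := by
  rw [lintegral_eexp_sum_of_iid (isIIDStdGaussian_pi ι) Finset.univ]
  congr 1
  rw [Finset.mul_sum]
  refine Finset.sum_congr rfl fun l _ => ?_
  rw [mul_pow, Real.sq_sqrt (by positivity)]; ring

/-- Linearising the square with one extra Gaussian `h` and integrating over `g` first leaves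
`exp(h²/4 · ∑ c²)`, so the one-dimensional bound applies without identifying the law of `∑ g l * c
l`. -/
lemma lintegral_eexp_sq_linear_le {ι : Type*} [Fintype ι] (c : ι → ℝ) (hc : ∑ l, c l ^ 2 ≤ 1) :
    ∫⁻ g, eexp ((∑ l, g l * c l) ^ 2 / 4) ∂(Measure.pi fun _ : ι => gaussianReal 0 1) ≤ 2 := by
  have h1 : ∀ g : ι → ℝ, eexp ((∑ l, g l * c l) ^ 2 / 4) =
      ∫⁻ h, eexp (∑ l, √(1 / 2) * h * c l * g l) ∂gaussianReal 0 1 := by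
    intro g
    have : ∀ h : ℝ, ∑ l, √(1 / 2) * h * c l * g l = (√(1 / 2) * ∑ l, g l * c l) * h := by
      intro h
      rw [Finset.mul_sum, Finset.sum_mul]
      exact Finset.sum_congr rfl fun l _ => by ring
    simp_rw [this]
    rw [lintegral_eexp_gaussianReal, mul_pow, Real.sq_sqrt (by positivity)]
    congr 1; ring
  simp_rw [h1]
  rw [lintegral_lintegral_swap]
  · refine le_trans (lintegral_mono fun h => ?_) lintegral_eexp_sq_gaussianReal_le
    rw [lintegral_eexp_sum_of_iid (isIIDStdGaussian_pi ι) Finset.univ]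
    refine eexp_le_eexp ?_
    have : ∑ l, (√(1 / 2) * h * c l) ^ 2 / 2 = h ^ 2 / 4 * ∑ l, c l ^ 2 := by
      rw [Finset.mul_sum]
      refine Finset.sum_congr rfl fun l _ => ?_
      rw [mul_pow, mul_pow, Real.sq_sqrt (by positivity)]; ring
    rw [this]
    nlinarith [sq_nonneg h]
  · exact (Measurable.eexp (by fun_prop)).aemeasurable

/-- Jensen's inequality for the exponential, with weights of total mass at most one. -/
lemma eexp_sum_mul_le {ι : Type*} (s : Finset ι) (p x : ι → ℝ) (hp : ∀ i ∈ s, 0 ≤ p i)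
    (hp1 : ∑ i ∈ s, p i ≤ 1) :
    eexp (∑ i ∈ s, p i * x i) ≤
      ENNReal.ofReal (1 - ∑ i ∈ s, p i) + ∑ i ∈ s, ENNReal.ofReal (p i) * eexp (x i) := by
  have h := convexOn_exp.map_sum_le (t := Finset.insertNone s)
    (w := fun o : Option ι => o.elim (1 - ∑ i ∈ s, p i) p) (p := fun o : Option ι => o.elim 0 x)
    (by rintro (_ | i) hi
        · simpa using hp1
        · exact hp i (by simpa using hi))
    (by simp [Finset.sum_insertNone]) (by simp)
  simp only [Finset.sum_insertNone, Option.elim, smul_eq_mul, mul_zero, zero_add, Real.exp_zero,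
    mul_one] at h
  refine (ENNReal.ofReal_le_ofReal h).trans ?_
  rw [ENNReal.ofReal_add (by linarith) (Finset.sum_nonneg fun i hi => mul_nonneg (hp i hi)
    (Real.exp_pos _).le), ENNReal.ofReal_sum_of_nonneg fun i hi => mul_nonneg (hp i hi)
    (Real.exp_pos _).le]
  gcongr with i hi
  rw [ENNReal.ofReal_mul (hp i hi)]; rfl

/-- A Gaussian chaos with small trace has bounded exponential moment. -/
lemma lintegral_eexp_quadratic_le {L ι : Type*} [Fintype L] (s : Finset ι) (τ : ι → ℝ)
    (c : ι → L → ℝ) (hc : ∀ J ∈ s, ∑ l, c J l ^ 2 ≤ 1) (hτ : ∀ J ∈ s, 0 ≤ τ J)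
    (hτ1 : ∑ J ∈ s, τ J ≤ 1 / 4) :
    ∫⁻ g, eexp (∑ J ∈ s, τ J * (∑ l, g l * c J l) ^ 2)
      ∂(Measure.pi fun _ : L => gaussianReal 0 1) ≤ 2 := by
  have h1 : ∀ g : L → ℝ, eexp (∑ J ∈ s, τ J * (∑ l, g l * c J l) ^ 2) ≤
      ENNReal.ofReal (1 - ∑ J ∈ s, 4 * τ J) +
        ∑ J ∈ s, ENNReal.ofReal (4 * τ J) * eexp ((∑ l, g l * c J l) ^ 2 / 4) := by
    intro g
    -- Jensen with weights `4 τ J`, whose total is at most one by the trace bound; the missing mass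
    -- sits at exponent `0`.
    refine le_trans (le_of_eq ?_) (eexp_sum_mul_le s (fun J => 4 * τ J)
      (fun J => (∑ l, g l * c J l) ^ 2 / 4) (fun J hJ => by linarith [hτ J hJ]) ?_)
    · congr 1; exact Finset.sum_congr rfl fun J _ => by ring
    · rw [← Finset.mul_sum]; linarith
  have hm : ∀ J, Measurable fun g : L → ℝ => eexp ((∑ l, g l * c J l) ^ 2 / 4) :=
    fun J => Measurable.eexp (by fun_prop)
  refine (lintegral_mono h1).trans ?_
  rw [lintegral_add_left measurable_const, lintegral_finsetSum _ fun J _ => (hm J).const_mul _]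
  simp_rw [lintegral_const_mul _ (hm _)]
  have h4 : ∑ J ∈ s, 4 * τ J ≤ 1 := by rw [← Finset.mul_sum]; linarith
  calc _ ≤ ENNReal.ofReal (1 - ∑ J ∈ s, 4 * τ J) * 2 + ∑ J ∈ s, ENNReal.ofReal (4 * τ J) * 2 := by
        simp only [lintegral_const, measure_univ, mul_one]
        gcongr with J hJ
        · exact le_mul_of_one_le_right zero_le one_le_two
        · exact lintegral_eexp_sq_linear_le _ (hc J hJ)
    _ = 2 := by
        rw [← Finset.sum_mul, ← add_mul, ← ENNReal.ofReal_sum_of_nonneg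
          (fun J hJ => by linarith [hτ J hJ]), ← ENNReal.ofReal_add (by linarith)
          (Finset.sum_nonneg fun J hJ => by linarith [hτ J hJ])]
        simp

/-! ### Decoupling by weighted Cauchy–Schwarz. -/

lemma lintegral_pi_prod {ι : Type*} [Fintype ι] {E : ι → Type*} [∀ i, MeasurableSpace (E i)]
    (ν : ∀ i, Measure (E i)) [∀ i, IsProbabilityMeasure (ν i)] (f : ∀ i, E i → ENNReal)
    (hf : ∀ i, Measurable (f i)) :
    ∫⁻ g, ∏ i, f i (g i) ∂Measure.pi ν = ∏ i, ∫⁻ x, f i x ∂ν i := by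
  rw [lintegral_prod_eq_prod_lintegral_of_indepFun Finset.univ (fun i (g : ∀ i, E i) => f i (g i))
    (iIndepFun_pi fun i => (hf i).aemeasurable) fun i => (hf i).comp (measurable_pi_apply i)]
  refine Finset.prod_congr rfl fun i _ => ?_
  rw [← (measurePreserving_eval ν i).map_eq, lintegral_map (hf i) (measurable_pi_apply i)]

/-- Decoupling in coordinates: a weighted Cauchy–Schwarz inequality makes the blocks of a Gaussian
vector independent at the level of exponential moments of the squared norm. -/
lemma lintegral_eexp_sum_sq_le {Ω ι S L : Type*} [Fintype S] [Fintype L] [MeasurableSpace Ω]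
    {μ : Measure Ω} {a : ι → Ω → ℝ} (ha : IsIIDStdGaussian μ a) (s : Finset ι)
    (σ w : S → ι → ℝ) (e : S → ι → L → ℝ) (he : ∀ i, ∀ J ∈ s, ∑ l, e i J l ^ 2 ≤ 1)
    (hw : ∀ i, ∀ J ∈ s, 0 < w i J) (hw1 : ∀ J ∈ s, ∑ i, w i J ≤ 1) {lam : ℝ} (hlam : 0 ≤ lam)
    (hT : ∀ i, lam * ∑ J ∈ s, σ i J ^ 2 / w i J ≤ 1 / 4) :
    ∫⁻ ω, eexp (lam * ∑ i, ∑ l, (∑ J ∈ s, a J ω * (σ i J * e i J l)) ^ 2) ∂μ ≤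
      2 ^ Fintype.card S := by
  have : IsProbabilityMeasure μ := ha.indep.isProbabilityMeasure
  set γ : Measure (L → ℝ) := Measure.pi fun _ : L => gaussianReal 0 1 with hγ
  -- Each block gets its own auxiliary Gaussian vector `g i`; for fixed `g` the exponent is linear
  -- in the coefficients `a J`.
  have h1 : ∀ ω, eexp (lam * ∑ i, ∑ l, (∑ J ∈ s, a J ω * (σ i J * e i J l)) ^ 2) =
      ∫⁻ g : S → L → ℝ, eexp (∑ J ∈ s, (√(2 * lam) * ∑ i, σ i J * ∑ l, g i l * e i J l) * a J ω)
        ∂(Measure.pi fun _ : S => γ) := by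
    intro ω
    rw [Finset.mul_sum, eexp_sum]
    simp_rw [eexp_sum_sq_eq_lintegral hlam]
    rw [← lintegral_pi_prod _ _ fun i => Measurable.eexp (by fun_prop)]
    refine lintegral_congr fun g => ?_
    rw [← eexp_sum]
    congr 1
    simp_rw [Finset.mul_sum, Finset.sum_mul]
    rw [Finset.sum_comm]
    conv_rhs => enter [2, J]; rw [Finset.sum_comm]
    rw [Finset.sum_comm (s := s)]
    refine Finset.sum_congr rfl fun l _ => ?_
    rw [Finset.sum_comm]
    refine Finset.sum_congr rfl fun J _ => Finset.sum_congr rfl fun i _ => ?_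
    ring
  simp_rw [h1]
  rw [lintegral_lintegral_swap]
  swap
  · refine (Measurable.eexp ?_).aemeasurable
    refine Finset.measurable_sum _ fun J _ => Measurable.mul (by fun_prop) ?_
    exact (ha.measurable J).comp measurable_fst
  have h2 : ∀ g : S → L → ℝ,
      ∫⁻ ω, eexp (∑ J ∈ s, (√(2 * lam) * ∑ i, σ i J * ∑ l, g i l * e i J l) * a J ω) ∂μ ≤
        ∏ i, eexp (∑ J ∈ s, (lam * (σ i J ^ 2 / w i J)) * (∑ l, g i l * e i J l) ^ 2) := by
    intro g
    rw [lintegral_eexp_sum_of_iid ha, ← eexp_sum, Finset.sum_comm]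
    refine eexp_le_eexp (Finset.sum_le_sum fun J hJ => ?_)
    rw [mul_pow, Real.sq_sqrt (by positivity)]
    -- With `b i` the summands, `(∑ b i)² ≤ (∑ w i) (∑ b i² / w i)`. This removes the cross terms
    -- between blocks, so the integral over `g` factorises.
    have hcs := Finset.sum_sq_le_sum_mul_sum_of_sq_le_mul Finset.univ
      (r := fun i => σ i J * ∑ l, g i l * e i J l) (f := fun i => w i J)
      (g := fun i => σ i J ^ 2 / w i J * (∑ l, g i l * e i J l) ^ 2)
      (fun i _ => (hw i J hJ).le)
      (fun i _ => mul_nonneg (div_nonneg (sq_nonneg _) (hw i J hJ).le) (sq_nonneg _))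
      (fun i _ => by have := (hw i J hJ).ne'; exact le_of_eq (by field_simp))
    have hnn : 0 ≤ ∑ i, σ i J ^ 2 / w i J * (∑ l, g i l * e i J l) ^ 2 :=
      Finset.sum_nonneg fun i _ => mul_nonneg (div_nonneg (sq_nonneg _) (hw i J hJ).le)
        (sq_nonneg _)
    have h3 := hcs.trans (mul_le_of_le_one_left hnn (hw1 J hJ))
    simp_rw [mul_assoc lam]
    rw [← Finset.mul_sum]
    nlinarith [mul_le_mul_of_nonneg_left h3 hlam]
  refine (lintegral_mono h2).trans ?_
  rw [lintegral_pi_prod (fun _ : S => γ) (fun i (x : L → ℝ) =>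
    eexp (∑ J ∈ s, (lam * (σ i J ^ 2 / w i J)) * (∑ l, x l * e i J l) ^ 2))
    fun i => Measurable.eexp (by fun_prop)]
  refine (Finset.prod_le_prod' (g := fun _ => 2) fun i _ => ?_).trans (by simp)
  refine lintegral_eexp_quadratic_le s _ (e i) (he i) (fun J hJ => ?_) ?_
  · exact mul_nonneg hlam (div_nonneg (sq_nonneg _) (hw i J hJ).le)
  · rw [← Finset.mul_sum]; exact hT i

/-- Decoupling for Hilbert-space-valued linear functions of i.i.d. Gaussian variables. -/
lemma lintegral_eexp_sum_norm_sq_le {Ω ι S H : Type*} [Fintype S] [NormedAddCommGroup H]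
    [InnerProductSpace ℝ H] [MeasurableSpace Ω]
    {μ : Measure Ω} {a : ι → Ω → ℝ} (ha : IsIIDStdGaussian μ a) (s : Finset ι)
    (σ w : S → ι → ℝ) (e : S → ι → H) (he : ∀ i, ∀ J ∈ s, ‖e i J‖ ≤ 1)
    (hw : ∀ i, ∀ J ∈ s, 0 < w i J) (hw1 : ∀ J ∈ s, ∑ i, w i J ≤ 1) {lam : ℝ} (hlam : 0 ≤ lam)
    (hT : ∀ i, lam * ∑ J ∈ s, σ i J ^ 2 / w i J ≤ 1 / 4) :
    ∫⁻ ω, eexp (lam * ∑ i, ‖∑ J ∈ s, a J ω • σ i J • e i J‖ ^ 2) ∂μ ≤ 2 ^ Fintype.card S := by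
  classical
  -- Only finitely many vectors occur, so coordinates in an orthonormal basis of their span suffice.
  let E : Submodule ℝ H := Submodule.span ℝ
    (Set.range fun p : S × s => e p.1 p.2)
  have : FiniteDimensional ℝ E := FiniteDimensional.span_of_finite ℝ (Set.finite_range _)
  have hmem : ∀ i, ∀ J ∈ s, e i J ∈ E := fun i J hJ =>
    Submodule.subset_span ⟨(i, ⟨J, hJ⟩), rfl⟩
  let b := stdOrthonormalBasis ℝ E
  let e' : S → ι → E := fun i J => if h : J ∈ s then ⟨e i J, hmem i J h⟩ else 0
  have he' : ∀ i, ∀ J ∈ s, (e' i J : H) = e i J := fun i J hJ => by simp [e', hJ]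
  have hnorm : ∀ x : E, ∑ l, (inner ℝ (b l) x) ^ 2 = ‖x‖ ^ 2 := by
    intro x
    rw [← b.sum_sq_norm_inner_right x]
    simp
  refine le_trans (le_of_eq (lintegral_congr fun ω => ?_))
    (lintegral_eexp_sum_sq_le ha s σ w (fun i J l => inner ℝ (b l) (e' i J)) (fun i J hJ => ?_)
      hw hw1 hlam hT)
  · congr 3 with i
    have h1 : ‖∑ J ∈ s, a J ω • σ i J • e i J‖ = ‖∑ J ∈ s, a J ω • σ i J • e' i J‖ := by
      rw [Submodule.coe_norm, Submodule.coe_sum]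
      congr 1
      exact Finset.sum_congr rfl fun J hJ => by simp [he' i J hJ]
    rw [h1, ← hnorm]
    simp_rw [inner_sum, inner_smul_right]
  · rw [hnorm]
    have := he i J hJ
    rw [← he' i J hJ, ← Submodule.coe_norm] at this
    exact pow_le_one₀ (norm_nonneg _) this

/-! ### The exponential kernel and its feature map. -/

lemma HasSum.mul_three {f g k : ℕ → ℝ} {a b c : ℝ} (hf : HasSum f a) (hg : HasSum g b)
    (hk : HasSum k c) :
    HasSum (fun p : ℕ × ℕ × ℕ => f p.1 * (g p.2.1 * k p.2.2)) (a * (b * c)) := by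
  have hgk := hg.mul hk (summable_mul_of_summable_norm hg.summable.norm hk.summable.norm)
  exact hf.mul hgk (summable_mul_of_summable_norm hf.summable.norm hgk.summable.norm)

lemma Real.hasSum_exp (t : ℝ) : HasSum (fun k : ℕ => t ^ k / (k.factorial : ℝ)) (Real.exp t) := by
  rw [Real.exp_eq_exp_ℝ]; exact NormedSpace.expSeries_div_hasSum_exp t

/-- A feature map for the exponential kernel `exp (v ⬝ w)` on `ℝ³`. -/
noncomputable def expFeatureFun (v : Fin 3 → ℝ) (p : ℕ × ℕ × ℕ) : ℝ :=
  v 0 ^ p.1 / √(p.1.factorial : ℝ) *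
    (v 1 ^ p.2.1 / √(p.2.1.factorial : ℝ) * (v 2 ^ p.2.2 / √(p.2.2.factorial : ℝ)))

lemma hasSum_expFeatureFun_mul (v w : Fin 3 → ℝ) :
    HasSum (fun p => expFeatureFun v p * expFeatureFun w p) (Real.exp (∑ j, v j * w j)) := by
  rw [Fin.sum_univ_three, add_assoc, Real.exp_add, Real.exp_add]
  refine ((Real.hasSum_exp _).mul_three (Real.hasSum_exp _) (Real.hasSum_exp _)).congr_fun
    fun p => ?_
  have h : ∀ k : ℕ, ∀ a b : ℝ, (a * b) ^ k / (k.factorial : ℝ) =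
      (a ^ k / √(k.factorial : ℝ)) * (b ^ k / √(k.factorial : ℝ)) := fun k a b => by
    rw [div_mul_div_comm, Real.mul_self_sqrt (by positivity), mul_pow]
  simp only [expFeatureFun, h]
  ring

lemma memℓp_expFeatureFun (v : Fin 3 → ℝ) : Memℓp (expFeatureFun v) 2 := by
  refine memℓp_gen ?_
  refine (hasSum_expFeatureFun_mul v v).summable.congr fun p => ?_
  simp [← sq]

/-- The feature map of the exponential kernel, with values in a Hilbert space. -/
noncomputable def expFeature (v : Fin 3 → ℝ) : lp (fun _ : ℕ × ℕ × ℕ => ℝ) 2 :=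
  ⟨expFeatureFun v, memℓp_expFeatureFun v⟩

lemma inner_expFeature (v w : Fin 3 → ℝ) :
    inner ℝ (expFeature v) (expFeature w) = Real.exp (∑ j, v j * w j) := by
  refine (lp.hasSum_inner (𝕜 := ℝ) (expFeature v) (expFeature w)).unique ?_
  refine (hasSum_expFeatureFun_mul v w).congr_fun fun p => ?_
  simp [expFeature, mul_comm]

lemma norm_expFeature_sq (v : Fin 3 → ℝ) :
    ‖expFeature v‖ ^ 2 = Real.exp (∑ j, v j ^ 2) := by
  rw [← real_inner_self_eq_norm_sq, inner_expFeature]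
  simp_rw [sq]

lemma norm_expFeature (v : Fin 3 → ℝ) :
    ‖expFeature v‖ = Real.exp ((∑ j, v j ^ 2) / 2) := by
  refine (sq_eq_sq₀ (norm_nonneg _) (Real.exp_pos _).le).1 ?_
  rw [norm_expFeature_sq, ← Real.exp_nat_mul]
  congr 1; push_cast; ring

/-! ### Gaussian moments of multinomial fluctuations. -/

lemma Real.exp_le_self_add_exp_sq (x : ℝ) : Real.exp x ≤ x + Real.exp (x ^ 2) := by
  have h1 := Real.add_one_le_exp (x ^ 2)
  rcases le_or_gt |x| 1 with h | h
  · have := (abs_le.1 (Real.abs_exp_sub_one_sub_id_le h)).2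
    linarith
  · rcases lt_abs.1 h with h | h
    · have : Real.exp x ≤ Real.exp (x ^ 2) := Real.exp_le_exp.2 (by nlinarith)
      linarith
    · have : Real.exp x ≤ 1 := Real.exp_le_one_iff.2 (by linarith)
      nlinarith

/-- The weight of `J` under the multinomial distribution with parameters `∑ j, J j` and `p`. -/
noncomputable def multinomialWeight (p : Fin 3 → ℝ) (J : Fin 3 → ℕ) : ℝ :=
  (Nat.multinomial Finset.univ J : ℝ) * ∏ j, p j ^ J j

lemma multinomialWeight_nonneg {p : Fin 3 → ℝ} (hp : ∀ j, 0 ≤ p j) (J : Fin 3 → ℕ) :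
    0 ≤ multinomialWeight p J :=
  mul_nonneg (Nat.cast_nonneg _) (Finset.prod_nonneg fun j _ => pow_nonneg (hp j) _)

/-- By the multinomial theorem the sum is `(∑ p_j exp(s_j - m))^n` with `m` the mean of `s`. In `exp
y ≤ y + exp(y²)` the linear terms cancel on averaging, and `(s_j - m)² ≤ 2 s_j² + 2 m² ≤ 4 ∑ s²`
gives the constant. -/
lemma sum_multinomialWeight_mul_exp_le (n : ℕ) {p : Fin 3 → ℝ} (hp : ∀ j, 0 ≤ p j)
    (hp1 : ∑ j, p j = 1) (s : Fin 3 → ℝ) :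
    ∑ J ∈ Finset.piAntidiag Finset.univ n, multinomialWeight p J *
      Real.exp (∑ j, s j * ((J j : ℝ) - n * p j)) ≤ Real.exp (4 * n * ∑ j, s j ^ 2) := by
  set m := ∑ j, s j * p j with hm
  have h1 : ∀ J ∈ Finset.piAntidiag (Finset.univ : Finset (Fin 3)) n, multinomialWeight p J *
      Real.exp (∑ j, s j * ((J j : ℝ) - n * p j)) =
      Nat.multinomial Finset.univ J * ∏ j, (p j * Real.exp (s j - m)) ^ J j := by
    intro J hJ
    have hJn : ∑ j, (J j : ℝ) = n := by
      rw [← (Finset.mem_piAntidiag.1 hJ).1]; push_cast; rfl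
    simp_rw [multinomialWeight, mul_pow, Finset.prod_mul_distrib, ← Real.exp_nat_mul]
    rw [← Real.exp_sum, mul_assoc]
    congr 3
    simp_rw [mul_sub, Finset.sum_sub_distrib]
    rw [← Finset.sum_mul, hJn, hm, Finset.mul_sum]
    congr 1
    · exact Finset.sum_congr rfl fun j _ => mul_comm _ _
    · exact Finset.sum_congr rfl fun j _ => by ring
  rw [Finset.sum_congr rfl h1, ← Finset.sum_pow_eq_sum_piAntidiag, mul_comm 4, mul_assoc,
    Real.exp_nat_mul]
  refine pow_le_pow_left₀ (Finset.sum_nonneg fun j _ => mul_nonneg (hp j) (Real.exp_pos _).le) ?_ n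
  have hp1' : ∀ j, p j ≤ 1 := fun j => hp1 ▸ Finset.single_le_sum (fun i _ => hp i)
    (Finset.mem_univ j)
  have hm2 : m ^ 2 ≤ ∑ j, s j ^ 2 := by
    have := Finset.sum_mul_sq_le_sq_mul_sq Finset.univ s p
    have h2 : ∑ j, p j ^ 2 ≤ 1 := hp1 ▸ Finset.sum_le_sum fun j _ => by
      nlinarith [hp j, hp1' j]
    have h3 : 0 ≤ ∑ j, s j ^ 2 := Finset.sum_nonneg fun j _ => sq_nonneg _
    nlinarith
  have h2 : ∀ j, p j * Real.exp (s j - m) ≤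
      p j * (s j - m) + p j * Real.exp (4 * ∑ i, s i ^ 2) := by
    intro j
    rw [← mul_add]
    refine mul_le_mul_of_nonneg_left ((Real.exp_le_self_add_exp_sq _).trans ?_) (hp j)
    gcongr
    have : s j ^ 2 ≤ ∑ i, s i ^ 2 :=
      Finset.single_le_sum (f := fun i => s i ^ 2) (fun i _ => sq_nonneg _) (Finset.mem_univ j)
    nlinarith [sq_nonneg (s j + m)]
  refine (Finset.sum_le_sum fun j _ => h2 j).trans (le_of_eq ?_)
  rw [Finset.sum_add_distrib, ← Finset.sum_mul, hp1, one_mul]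
  simp_rw [mul_sub, Finset.sum_sub_distrib]
  rw [← Finset.sum_mul, hp1, one_mul, hm]
  simp_rw [mul_comm (s _)]
  simp

/-- Gaussian moment of the rescaled fluctuations of a multinomial variable. -/
lemma sum_multinomialWeight_mul_exp_sq_le {n : ℕ} (hn : 0 < n) {p : Fin 3 → ℝ}
    (hp : ∀ j, 0 ≤ p j) (hp1 : ∑ j, p j = 1) :
    ∑ J ∈ Finset.piAntidiag Finset.univ n, multinomialWeight p J *
      Real.exp (1 / 32 * ∑ j, (((J j : ℝ) - n * p j) / √n) ^ 2) ≤ 8 := by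
  have hn' : (0 : ℝ) < n := by exact_mod_cast hn
  have hw := fun J => multinomialWeight_nonneg hp J
  rw [← ENNReal.ofReal_le_ofReal_iff (by norm_num),
    ENNReal.ofReal_sum_of_nonneg fun J _ => mul_nonneg (hw J) (Real.exp_pos _).le]
  -- Linearisation with `√(2/32) = 1/4` gives slopes `g j / (4√n)`, for which the preceding bound is
  -- exactly `∏ exp(g j² / 4)`; each of the three factors integrates to at most `2`.
  have h1 : ∀ J : Fin 3 → ℕ, ENNReal.ofReal (multinomialWeight p J *
      Real.exp (1 / 32 * ∑ j, (((J j : ℝ) - n * p j) / √n) ^ 2)) =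
      ∫⁻ g, ENNReal.ofReal (multinomialWeight p J *
        Real.exp (∑ j, g j / (4 * √n) * ((J j : ℝ) - n * p j)))
        ∂Measure.pi fun _ : Fin 3 => gaussianReal 0 1 := by
    intro J
    rw [ENNReal.ofReal_mul (hw J)]
    change _ * eexp _ = _
    rw [eexp_sum_sq_eq_lintegral (by norm_num), ← lintegral_const_mul _
      (Measurable.eexp (by fun_prop))]
    refine lintegral_congr fun g => ?_
    rw [ENNReal.ofReal_mul (hw J)]
    congr 2
    refine Finset.sum_congr rfl fun j _ => ?_
    rw [show (2 : ℝ) * (1 / 32) = (1 / 4) ^ 2 by norm_num, Real.sqrt_sq (by norm_num)]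
    field_simp
  simp_rw [h1]
  rw [← lintegral_finsetSum _ fun J _ => by fun_prop]
  have h2 : ∀ g : Fin 3 → ℝ, ∑ J ∈ Finset.piAntidiag Finset.univ n,
      ENNReal.ofReal (multinomialWeight p J *
        Real.exp (∑ j, g j / (4 * √n) * ((J j : ℝ) - n * p j))) ≤ ∏ j, eexp (g j ^ 2 / 4) := by
    intro g
    rw [← ENNReal.ofReal_sum_of_nonneg fun J _ => mul_nonneg (hw J) (Real.exp_pos _).le,
      ← eexp_sum]
    refine ENNReal.ofReal_le_ofReal ((sum_multinomialWeight_mul_exp_le n hp hp1 _).trans ?_)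
    refine Real.exp_le_exp.2 (le_of_eq ?_)
    rw [Finset.mul_sum]
    refine Finset.sum_congr rfl fun j _ => ?_
    rw [div_pow, mul_pow, Real.sq_sqrt hn'.le]
    field_simp
  refine (lintegral_mono h2).trans ?_
  rw [lintegral_pi_prod (fun _ : Fin 3 => gaussianReal 0 1) (fun _ x => eexp (x ^ 2 / 4))
    fun _ => Measurable.eexp (by fun_prop)]
  refine (Finset.prod_le_prod' (g := fun _ => 2) fun j _ =>
    lintegral_eexp_sq_gaussianReal_le).trans ?_
  rw [show (8 : ℝ) = 2 ^ 3 by norm_num, ENNReal.ofReal_pow (by norm_num)]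
  simp

/-! ### Packing of separated points. -/

lemma summable_exp_neg_mul_int_sq {c : ℝ} (hc : 0 < c) :
    Summable fun d : ℤ => Real.exp (-c * (d : ℝ) ^ 2) := by
  have h := ((Real.summable_one_div_int_pow (p := 2)).2 one_lt_two).mul_left (1 / c)
  refine Summable.of_norm_bounded_eventually h ?_
  have : {(0 : ℤ)}ᶜ ∈ Filter.cofinite := (Set.finite_singleton 0).compl_mem_cofinite
  filter_upwards [this] with d hd
  have hd' : (0 : ℝ) < (d : ℝ) ^ 2 := by
    have : (d : ℝ) ≠ 0 := by exact_mod_cast hd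
    positivity
  rw [Real.norm_eq_abs, Real.abs_exp, neg_mul, Real.exp_neg, one_div_mul_one_div, one_div]
  exact inv_anti₀ (by positivity) ((Real.add_one_le_exp _).trans' (by linarith))

/-- Points with distinct integer parts satisfy a uniform Gaussian packing bound. -/
lemma exists_packing_bound {κ h : ℝ} (hκ : 0 < κ) (hh : 0 < h) :
    ∃ B : ℝ, 0 < B ∧ ∀ {S : Type} [Fintype S] (y : S → Fin 3 → ℝ),
      (Function.Injective fun i j => ⌊y i j / h⌋) → ∀ q : Fin 3 → ℝ,
        ∑ i, Real.exp (-κ * ∑ j, (q j - y i j) ^ 2) ≤ B := by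
  classical
  -- Rounding changes a difference by at most one, so the integer difference satisfies `d² ≤ 2 (B -
  -- A)² + 2`. This halves the rate and costs the factor `exp(κ h²)`.
  set g : ℤ → ℝ := fun d => Real.exp (κ * h ^ 2) * Real.exp (-(κ * h ^ 2 / 2) * (d : ℝ) ^ 2)
    with hg
  have hgs : Summable g := (summable_exp_neg_mul_int_sq (by positivity)).mul_left _
  have hg0 : ∀ d, 0 < g d := fun d => by positivity
  refine ⟨(∑' d, g d) ^ 3, pow_pos (hgs.tsum_pos (fun d => (hg0 d).le) 0 (hg0 0)) 3, ?_⟩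
  intro S _ y hy q
  have hterm : ∀ a b : ℝ, Real.exp (-κ * (a - b) ^ 2) ≤ g (⌊b / h⌋ - ⌊a / h⌋) := by
    intro a b
    rw [hg]
    simp only
    rw [← Real.exp_add]
    refine Real.exp_le_exp.2 ?_
    push_cast
    set A := a / h
    set B := b / h
    have ha : a = A * h := by simp [A]; field_simp
    have hb : b = B * h := by simp [B]; field_simp
    have h1 : |(⌊B⌋ - ⌊A⌋ : ℝ)| ≤ |B - A| + 1 := by
      have := Int.floor_le A; have := Int.lt_floor_add_one A
      have := Int.floor_le B; have := Int.lt_floor_add_one B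
      rcases abs_cases (B - A) with h | h <;> rcases abs_cases (⌊B⌋ - ⌊A⌋ : ℝ) with h' | h' <;>
        linarith
    have h2 : (⌊B⌋ - ⌊A⌋ : ℝ) ^ 2 ≤ 2 * (B - A) ^ 2 + 2 := by
      rw [← sq_abs, ← sq_abs (B - A)]
      have := pow_le_pow_left₀ (abs_nonneg _) h1 2
      nlinarith [sq_nonneg (|B - A| - 1)]
    rw [ha, hb]
    have : 0 < κ * h ^ 2 := by positivity
    nlinarith
  calc ∑ i, Real.exp (-κ * ∑ j, (q j - y i j) ^ 2)
      ≤ ∑ i, ∏ j, g (⌊y i j / h⌋ - ⌊q j / h⌋) := by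
        refine Finset.sum_le_sum fun i _ => ?_
        rw [Finset.mul_sum, Real.exp_sum]
        exact Finset.prod_le_prod (fun j _ => (Real.exp_pos _).le) fun j _ => hterm _ _
    _ = ∑ d ∈ Finset.univ.image fun i j => ⌊y i j / h⌋ - ⌊q j / h⌋, ∏ j, g (d j) := by
        rw [Finset.sum_image]
        intro i _ i' _ hii
        refine hy (funext fun j => ?_)
        have := congrFun hii j
        simpa using this
    -- Distinct integer vectors are enlarged to a full box, over which the sum factorises.
    _ ≤ ∑ d ∈ Fintype.piFinset fun j => Finset.univ.image fun i => ⌊y i j / h⌋ - ⌊q j / h⌋,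
          ∏ j, g (d j) := by
        refine Finset.sum_le_sum_of_subset_of_nonneg (fun d hd => ?_)
          fun d _ _ => Finset.prod_nonneg fun j _ => (hg0 _).le
        obtain ⟨i, -, rfl⟩ := Finset.mem_image.1 hd
        exact Fintype.mem_piFinset.2 fun j => Finset.mem_image_of_mem _ (Finset.mem_univ i)
    _ = ∏ j, ∑ d ∈ Finset.univ.image fun i => ⌊y i j / h⌋ - ⌊q j / h⌋, g d := by
        rw [Finset.prod_univ_sum]
    _ ≤ ∏ _j : Fin 3, ∑' d, g d :=
        Finset.prod_le_prod (fun j _ => Finset.sum_nonneg fun d _ => (hg0 d).le)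
          fun j _ => hgs.sum_le_tsum _ fun d _ => (hg0 d).le
    _ = _ := by simp

/-! ### Geometry of the sphere inside the orthant. -/

lemma S2.sum_sq (x : S2) : ∑ j, x.1 j ^ 2 = 1 := by
  have h : ‖x.1‖ ^ 2 = 1 := by rw [norm_eq_of_mem_sphere]; norm_num
  rw [EuclideanSpace.norm_sq_eq] at h
  simpa using h

lemma cos_sphDist (x y : S2) : Real.cos (sphDist x y) = 1 - (∑ j, (x.1 j - y.1 j) ^ 2) / 2 := by
  have hx : ‖x.1‖ = 1 := norm_eq_of_mem_sphere x
  have hy : ‖y.1‖ = 1 := norm_eq_of_mem_sphere y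
  rw [sphDist, InnerProductGeometry.cos_angle, hx, hy]
  have h1 := norm_sub_sq_real x.1 y.1
  rw [EuclideanSpace.norm_sq_eq, hx, hy] at h1
  simp only [PiLp.sub_apply, Real.norm_eq_abs, sq_abs] at h1
  linarith

lemma abs_sub_le_sphDist (x y : S2) (j : Fin 3) : |x.1 j - y.1 j| ≤ sphDist x y := by
  have h1 := cos_sphDist x y
  have h2 := Real.one_sub_sq_div_two_le_cos (x := sphDist x y)
  have h3 : (x.1 j - y.1 j) ^ 2 ≤ ∑ i, (x.1 i - y.1 i) ^ 2 :=
    Finset.single_le_sum (f := fun i => (x.1 i - y.1 i) ^ 2) (fun i _ => sq_nonneg _)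
      (Finset.mem_univ j)
  exact abs_le_of_sq_le_sq (by linarith) (InnerProductGeometry.angle_nonneg _ _)

/-- This is where the orthant matters: `x_j + y_j ≥ 2δ`, so small differences of squares force small
differences of coordinates. These would give a squared chord of at most `3r²/16`, whereas angle at
least `r` forces at least `4r²/π² ≥ r²/4`. -/
lemma exists_sq_sub_gt_of_le_sphDist {δ r : ℝ} (hδ : 0 < δ) (hr : 0 < r) {x y : S2}
    (hx : ∀ j, δ ≤ x.1 j) (hy : ∀ j, δ ≤ y.1 j) (hxy : r ≤ sphDist x y) :
    ∃ j, δ / 2 * r < |x.1 j ^ 2 - y.1 j ^ 2| := by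
  by_contra! hcon
  have hd0 : 0 ≤ sphDist x y := InnerProductGeometry.angle_nonneg _ _
  have hdpi : sphDist x y ≤ Real.pi := InnerProductGeometry.angle_le_pi _ _
  have h1 := Real.cos_le_one_sub_mul_cos_sq (x := sphDist x y) (by rwa [abs_of_nonneg hd0])
  rw [cos_sphDist] at h1
  have h2 : ∀ j, (x.1 j - y.1 j) ^ 2 ≤ (r / 4) ^ 2 := by
    intro j
    have h3 : x.1 j ^ 2 - y.1 j ^ 2 = (x.1 j - y.1 j) * (x.1 j + y.1 j) := by ring
    have h4 := hcon j
    have h6 : 0 < x.1 j + y.1 j := by linarith [hx j, hy j]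
    rw [h3, abs_mul, abs_of_pos h6] at h4
    have h5 : |x.1 j - y.1 j| ≤ r / 4 := by
      by_contra! h7
      have : r / 4 * (2 * δ) < |x.1 j - y.1 j| * (x.1 j + y.1 j) :=
        mul_lt_mul h7 (by linarith [hx j, hy j]) (by positivity) (abs_nonneg _)
      nlinarith
    rw [← sq_abs]
    exact pow_le_pow_left₀ (abs_nonneg _) h5 2
  have h3 : ∑ j, (x.1 j - y.1 j) ^ 2 ≤ 3 * (r / 4) ^ 2 := by
    refine (Finset.sum_le_sum fun j _ => h2 j).trans (le_of_eq (by simp))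
  have h4 : r ^ 2 ≤ sphDist x y ^ 2 := pow_le_pow_left₀ hr.le hxy 2
  have h5 : 2 / Real.pi ^ 2 * r ^ 2 ≤ 2 / Real.pi ^ 2 * sphDist x y ^ 2 :=
    mul_le_mul_of_nonneg_left h4 (by positivity)
  have h6 : (1 : ℝ) / 8 ≤ 2 / Real.pi ^ 2 := by
    rw [div_le_div_iff₀ (by norm_num) (by positivity)]
    nlinarith [Real.pi_le_four, Real.pi_pos]
  have : 0 < r ^ 2 := by positivity
  nlinarith

/-- A subset of a cap of radius `u` has a finite net of mesh `1 / √n` of polynomial size. -/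
lemma exists_net {n : ℕ} (hn : 1 ≤ n) {u : ℝ} (hu : 1 / √(n : ℝ) ≤ u) {U : Set S2} {c : S2}
    (hU : U ⊆ sphCap c u) :
    ∃ X : Finset S2, (∀ x ∈ X, x ∈ U) ∧ (X.card : ℝ) ≤ (2 * u * √(n : ℝ)) ^ 6 ∧
      ∀ x ∈ U, ∃ x₀ ∈ X, ∀ j, |x.1 j - x₀.1 j| ≤ 1 / √(n : ℝ) := by
  classical
  have hs : 0 < √(n : ℝ) := Real.sqrt_pos.2 (by exact_mod_cast hn)
  have hM : 2 ≤ 2 * u * √(n : ℝ) := by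
    rw [div_le_iff₀ hs] at hu; linarith
  let F : S2 → Fin 3 → ℤ := fun x j => ⌊√(n : ℝ) * x.1 j⌋
  let box : Finset (Fin 3 → ℤ) := Fintype.piFinset fun j =>
    Finset.Icc ⌊√(n : ℝ) * (c.1 j - u)⌋ ⌊√(n : ℝ) * (c.1 j + u)⌋
  have hbox : F '' U ⊆ box := by
    rintro _ ⟨x, hx, rfl⟩
    refine Finset.mem_coe.2 (Fintype.mem_piFinset.2 fun j => Finset.mem_Icc.2 ?_)
    have h1 := abs_le.1 ((abs_sub_le_sphDist c x j).trans (hU hx))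
    constructor <;> refine Int.floor_le_floor (mul_le_mul_of_nonneg_left ?_ hs.le) <;> linarith
  have hfin : (F '' U).Finite := box.finite_toSet.subset hbox
  have hchoose : ∀ z ∈ F '' U, ∃ x ∈ U, F x = z := fun z hz => hz
  have : Nonempty S2 := ⟨c⟩
  choose! G hG using hchoose
  refine ⟨hfin.toFinset.image G, ?_, ?_, ?_⟩
  · intro x hx
    obtain ⟨z, hz, rfl⟩ := Finset.mem_image.1 hx
    exact (hG z (hfin.mem_toFinset.1 hz)).1
  · have h1 : (hfin.toFinset.image G).card ≤ box.card :=
      Finset.card_image_le.trans (Finset.card_le_card fun z hz =>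
        Finset.mem_coe.1 (hbox (hfin.mem_toFinset.1 hz)))
    -- Each coordinate takes at most `M + 2 ≤ M²` integer values, where `M = 2u√n ≥ 2`.
    have h2 : (box.card : ℝ) ≤ ∏ _j : Fin 3, (2 * u * √(n : ℝ)) ^ 2 := by
      rw [Fintype.card_piFinset]
      push_cast
      refine Finset.prod_le_prod (fun j _ => Nat.cast_nonneg _) fun j _ => ?_
      rw [Int.card_Icc]
      have h3 := Int.floor_le (√(n : ℝ) * (c.1 j + u))
      have h4 := Int.lt_floor_add_one (√(n : ℝ) * (c.1 j - u))
      have h5 : ⌊√(n : ℝ) * (c.1 j - u)⌋ ≤ ⌊√(n : ℝ) * (c.1 j + u)⌋ + 1 := by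
        have : ⌊√(n : ℝ) * (c.1 j - u)⌋ ≤ ⌊√(n : ℝ) * (c.1 j + u)⌋ :=
          Int.floor_le_floor (by nlinarith)
        omega
      rw [← Int.cast_natCast, Int.toNat_of_nonneg (by omega)]
      push_cast
      nlinarith
    calc ((hfin.toFinset.image G).card : ℝ) ≤ box.card := by exact_mod_cast h1
      _ ≤ _ := h2
      _ = _ := by simp; ring
  · intro x hx
    have hz : F x ∈ F '' U := ⟨x, hx, rfl⟩
    refine ⟨G (F x), Finset.mem_image_of_mem _ (hfin.mem_toFinset.2 hz), fun j => ?_⟩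
    have h1 := congrFun (hG (F x) hz).2 j
    have h2 := Int.abs_sub_lt_one_of_floor_eq_floor h1
    rw [← mul_sub, abs_mul, abs_of_pos hs] at h2
    rw [abs_sub_comm, le_div_iff₀ hs, mul_comm]
    exact h2.le

/-! ### Local control of parts of the polynomial by Hilbert-space vectors. -/

/-- The rescaled fluctuation of the multi-index `J` around its mean at the point `x`. -/
noncomputable def fluctuation (n : ℕ) (x : S2) (J : Fin 3 → ℕ) (j : Fin 3) : ℝ :=
  ((J j : ℝ) - n * x.1 j ^ 2) / √(n : ℝ)

open Classical in
/-- The standard deviation of the contribution of the multi-index `J ∈ D` at the point `x`. -/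
noncomputable def amplitude (D : Set (Fin 3 → ℕ)) (x : S2) (J : Fin 3 → ℕ) : ℝ :=
  if J ∈ D then √(multinomialWeight (fun j => x.1 j ^ 2) J) else 0

/-- A Hilbert-space-valued linear function of the coefficients whose norm controls, in a
neighbourhood of `x` of size `1 / √n`, the part of the polynomial with multi-indices in `D`. -/
noncomputable def localVector (κ : ℝ) (n : ℕ) (D : Set (Fin 3 → ℕ)) (x : S2)
    (c : (Fin 3 → ℕ) → ℝ) : lp (fun _ : ℕ × ℕ × ℕ => ℝ) 2 :=
  ∑ J ∈ Finset.piAntidiag Finset.univ n,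
    c J • amplitude D x J • expFeature fun j => √κ * fluctuation n x J j

open Classical in
/-- The part of the random polynomial with multi-indices in `D`. -/
noncomputable def kostlanPart (n : ℕ) (D : Set (Fin 3 → ℕ)) (c : (Fin 3 → ℕ) → ℝ) : C(S2, ℝ) :=
  kostlan n fun J => if J ∈ D then c J else 0

lemma kostlanPart_add_compl (n : ℕ) (D : Set (Fin 3 → ℕ)) (c : (Fin 3 → ℕ) → ℝ) (x : S2) :
    kostlanPart n D c x + kostlanPart n Dᶜ c x = kostlan n c x := by
  classical
  simp only [kostlanPart, kostlan, ContinuousMap.coe_mk]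
  rw [← Finset.sum_add_distrib]
  refine Finset.sum_congr rfl fun J _ => ?_
  by_cases h : J ∈ D <;> simp [h]

/-- Write `x^J = x₀^J exp(∑ J_j θ_j)` with `θ_j = log(x_j / x₀_j)` and split `J_j` into its mean `n
x₀_j²` and its fluctuation. The mean gives the prefactor; the fluctuation gives an exponential
kernel, which separates `J` from `x`. -/
lemma kostlanPart_eq_inner {κ : ℝ} (hκ : 0 < κ) {n : ℕ} (hn : 1 ≤ n) (D : Set (Fin 3 → ℕ))
    (c : (Fin 3 → ℕ) → ℝ) {x x₀ : S2} (hx : ∀ j, 0 < x.1 j) (hx₀ : ∀ j, 0 < x₀.1 j) :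
    kostlanPart n D c x = Real.exp (n * ∑ j, x₀.1 j ^ 2 * Real.log (x.1 j / x₀.1 j)) *
      inner ℝ (localVector κ n D x₀ c)
        (expFeature fun j => √(n : ℝ) * Real.log (x.1 j / x₀.1 j) / √κ) := by
  classical
  have hs : 0 < √(n : ℝ) := Real.sqrt_pos.2 (by exact_mod_cast hn)
  have hss : √(n : ℝ) * √(n : ℝ) = n := Real.mul_self_sqrt (Nat.cast_nonneg _)
  have hk : 0 < √κ := Real.sqrt_pos.2 hκ
  simp only [kostlanPart, kostlan, ContinuousMap.coe_mk, localVector]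
  rw [sum_inner, Finset.mul_sum]
  refine Finset.sum_congr rfl fun J _ => ?_
  rw [real_inner_smul_left, real_inner_smul_left, inner_expFeature]
  by_cases hJ : J ∈ D
  swap
  · simp [amplitude, hJ]
  simp only [amplitude, hJ, if_true, multinomialWeight]
  set θ : Fin 3 → ℝ := fun j => Real.log (x.1 j / x₀.1 j) with hθ
  have h1 : ∏ j, x.1 j ^ J j = (∏ j, x₀.1 j ^ J j) * Real.exp (∑ j, J j * θ j) := by
    rw [Real.exp_sum, ← Finset.prod_mul_distrib]
    refine Finset.prod_congr rfl fun j _ => ?_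
    rw [Real.exp_nat_mul, hθ, Real.exp_log (div_pos (hx j) (hx₀ j)), ← mul_pow,
      mul_div_cancel₀ _ (hx₀ j).ne']
  have h2 : √((Nat.multinomial Finset.univ J : ℝ) * ∏ j, (x₀.1 j ^ 2) ^ J j) =
      √(Nat.multinomial Finset.univ J : ℝ) * ∏ j, x₀.1 j ^ J j := by
    rw [Real.sqrt_mul (Nat.cast_nonneg _)]
    congr 1
    have : ∏ j, (x₀.1 j ^ 2) ^ J j = (∏ j, x₀.1 j ^ J j) ^ 2 := by
      rw [← Finset.prod_pow]
      exact Finset.prod_congr rfl fun j _ => by rw [← pow_mul, ← pow_mul, mul_comm]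
    rw [this, Real.sqrt_sq (Finset.prod_nonneg fun j _ => pow_nonneg (hx₀ j).le _)]
  have h3 : ∑ j, J j * θ j = n * ∑ j, x₀.1 j ^ 2 * θ j +
      ∑ j, √κ * fluctuation n x₀ J j * (√(n : ℝ) * θ j / √κ) := by
    rw [Finset.mul_sum, ← Finset.sum_add_distrib]
    refine Finset.sum_congr rfl fun j _ => ?_
    rw [fluctuation]
    field_simp
    ring
  rw [h1, h2, h3, Real.exp_add]
  ring

lemma abs_log_div_le {δ e a b : ℝ} (hδ : 0 < δ) (ha : δ ≤ a) (hb : δ ≤ b) (hab : |a - b| ≤ e) :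
    |Real.log (a / b)| ≤ e / δ := by
  have ha' : 0 < a := hδ.trans_le ha
  have hb' : 0 < b := hδ.trans_le hb
  have he : 0 ≤ e := (abs_nonneg _).trans hab
  have key : ∀ a b : ℝ, δ ≤ b → 0 < a → a - b ≤ e → Real.log (a / b) ≤ e / δ := by
    intro a b hb ha hab
    have hb' : 0 < b := hδ.trans_le hb
    have h1 := Real.log_le_sub_one_of_pos (div_pos ha hb')
    have h2 : a / b - 1 ≤ e / b := by
      rw [div_sub_one hb'.ne']; gcongr
    exact h1.trans (h2.trans (by gcongr))
  obtain ⟨h1, h2⟩ := abs_le.1 hab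
  refine abs_le.2 ⟨?_, key a b hb ha' h2⟩
  have := key b a ha hb' (by linarith)
  rw [← inv_div, Real.log_inv] at this
  linarith

lemma abs_kostlanPart_le {κ δ : ℝ} (hκ : 0 < κ) (hδ : 0 < δ) {n : ℕ} (hn : 1 ≤ n)
    (D : Set (Fin 3 → ℕ)) (c : (Fin 3 → ℕ) → ℝ) {x x₀ : S2} (hx : ∀ j, δ ≤ x.1 j)
    (hx₀ : ∀ j, δ ≤ x₀.1 j) (hxx : ∀ j, |x.1 j - x₀.1 j| ≤ 1 / √(n : ℝ)) :
    |kostlanPart n D c x| ≤ Real.exp (3 / (2 * κ * δ ^ 2)) * ‖localVector κ n D x₀ c‖ := by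
  have hn' : (0 : ℝ) < n := by exact_mod_cast hn
  have hs : 0 < √(n : ℝ) := Real.sqrt_pos.2 hn'
  have hpx : ∀ j, 0 < x.1 j := fun j => hδ.trans_le (hx j)
  have hpx₀ : ∀ j, 0 < x₀.1 j := fun j => hδ.trans_le (hx₀ j)
  rw [kostlanPart_eq_inner hκ hn D c hpx hpx₀, abs_mul, Real.abs_exp]
  -- Nonnegativity of relative entropy: `log y² ≤ y² - 1`, and the squares of the coordinates of
  -- both points sum to one.
  have h1 : Real.exp (n * ∑ j, x₀.1 j ^ 2 * Real.log (x.1 j / x₀.1 j)) ≤ 1 := by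
    refine Real.exp_le_one_iff.2 (mul_nonpos_of_nonneg_of_nonpos hn'.le ?_)
    have h2 : ∀ j, x₀.1 j ^ 2 * Real.log (x.1 j / x₀.1 j) ≤ (x.1 j ^ 2 - x₀.1 j ^ 2) / 2 := by
      intro j
      have hp := div_pos (hpx j) (hpx₀ j)
      have h3 := Real.log_le_sub_one_of_pos (pow_pos hp 2)
      rw [Real.log_pow] at h3
      push_cast at h3
      have h4 : x₀.1 j ^ 2 * (x.1 j / x₀.1 j) ^ 2 = x.1 j ^ 2 := by
        rw [← mul_pow, mul_div_cancel₀ _ (hpx₀ j).ne']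
      nlinarith [pow_pos (hpx₀ j) 2]
    refine (Finset.sum_le_sum fun j _ => h2 j).trans (le_of_eq ?_)
    rw [← Finset.sum_div, Finset.sum_sub_distrib, S2.sum_sq, S2.sum_sq]
    simp
  have h2 : ‖expFeature fun j => √(n : ℝ) * Real.log (x.1 j / x₀.1 j) / √κ‖ ≤
      Real.exp (3 / (2 * κ * δ ^ 2)) := by
    rw [norm_expFeature]
    refine Real.exp_le_exp.2 ?_
    have h3 : ∀ j, (√(n : ℝ) * Real.log (x.1 j / x₀.1 j) / √κ) ^ 2 ≤ 1 / (κ * δ ^ 2) := by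
      intro j
      have h4 := pow_le_pow_left₀ (abs_nonneg _)
        (abs_log_div_le hδ (hx j) (hx₀ j) (hxx j)) 2
      rw [sq_abs] at h4
      rw [div_pow, mul_pow, Real.sq_sqrt hn'.le, Real.sq_sqrt hκ.le]
      calc n * Real.log (x.1 j / x₀.1 j) ^ 2 / κ ≤ n * (1 / √(n : ℝ) / δ) ^ 2 / κ := by gcongr
        _ = 1 / (κ * δ ^ 2) := by
          rw [div_pow, div_pow, Real.sq_sqrt hn'.le]; field_simp
    have h5 := Finset.sum_le_sum fun j (_ : j ∈ Finset.univ) => h3 j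
    simp only [Finset.sum_const, Finset.card_univ, Fintype.card_fin, nsmul_eq_mul] at h5
    calc _ ≤ ((3 : ℕ) * (1 / (κ * δ ^ 2))) / 2 := by gcongr
      _ = _ := by push_cast; field_simp
  calc _ ≤ 1 * (‖localVector κ n D x₀ c‖ *
        ‖expFeature fun j => √(n : ℝ) * Real.log (x.1 j / x₀.1 j) / √κ‖) := by
        gcongr
        exact abs_real_inner_le_norm _ _
    _ ≤ _ := by
        rw [one_mul, mul_comm]; gcongr

lemma measurable_norm_localVector {Ω : Type*} [MeasurableSpace Ω] {a : (Fin 3 → ℕ) → Ω → ℝ}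
    (ha : ∀ J, Measurable (a J)) (κ : ℝ) (n : ℕ) (D : Set (Fin 3 → ℕ)) (x : S2) :
    Measurable fun ω => ‖localVector κ n D x fun J => a J ω‖ := by
  have h : Continuous fun c : (Fin 3 → ℕ) → ℝ => ‖localVector κ n D x c‖ := by
    unfold localVector; fun_prop
  exact h.measurable.comp (measurable_pi_iff.2 ha)

/-- Joint exponential moment of the squared norms of the local vectors at separated points. -/
lemma lintegral_eexp_sum_norm_localVector_le {Ω S : Type*} [Fintype S] [MeasurableSpace Ω]
    {μ : Measure Ω} {a : (Fin 3 → ℕ) → Ω → ℝ} (ha : IsIIDStdGaussian μ a) {n : ℕ} (hn : 1 ≤ n)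
    (x : S → S2) (D : S → Set (Fin 3 → ℕ)) {B ρ lam : ℝ} (hB : 0 < B)
    (hpack : ∀ J, ∑ i, Real.exp (-(1 / 96) * ∑ j, fluctuation n (x i) J j ^ 2) ≤ B)
    (hρ : 0 ≤ ρ) (hD : ∀ i, ∀ J ∈ D i, ∃ j, ρ ≤ |fluctuation n (x i) J j|) (hlam : 0 ≤ lam)
    (hlamB : lam * (8 * B * Real.exp (-(1 / 96) * ρ ^ 2)) ≤ 1 / 4) :
    ∫⁻ ω, eexp (lam * ∑ i, ‖localVector (1 / 96) n (D i) (x i) fun J => a J ω‖ ^ 2) ∂μ ≤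
      2 ^ Fintype.card S := by
  set Q : S → (Fin 3 → ℕ) → ℝ := fun i J => ∑ j, fluctuation n (x i) J j ^ 2 with hQ
  have hfeat : ∀ i J, ∑ j, (√(1 / 96) * fluctuation n (x i) J j) ^ 2 = 1 / 96 * Q i J := by
    intro i J
    rw [hQ, Finset.mul_sum]
    exact Finset.sum_congr rfl fun j _ => by rw [mul_pow, Real.sq_sqrt (by norm_num)]
  -- The feature vector is normalised, its norm `exp(Q/192)` moving into `σ`. The weights are the
  -- packing exponentials divided by `B`.
  have h := lintegral_eexp_sum_norm_sq_le ha (Finset.piAntidiag Finset.univ n)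
    (fun i J => amplitude (D i) (x i) J * Real.exp (1 / 96 * Q i J / 2))
    (fun i J => Real.exp (-(1 / 96) * Q i J) / B)
    (fun i J => Real.exp (-(1 / 96 * Q i J / 2)) •
      expFeature fun j => √(1 / 96) * fluctuation n (x i) J j)
    (fun i J _ => by
      rw [norm_smul, norm_expFeature, hfeat, Real.norm_eq_abs, Real.abs_exp, ← Real.exp_add]
      simp)
    (fun i J _ => by positivity)
    (fun J _ => by rw [← Finset.sum_div, div_le_one hB]; exact hpack J)
    hlam (fun i => ?_)
  · refine le_trans (le_of_eq (lintegral_congr fun ω => ?_)) h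
    congr 4 with i
    simp only [localVector, smul_smul]
    congr 2
    refine Finset.sum_congr rfl fun J _ => ?_
    rw [mul_assoc (amplitude _ _ _), ← Real.exp_add]
    simp
  · refine le_trans (mul_le_mul_of_nonneg_left ?_ hlam) hlamB
    have hp1 : ∑ j, (x i).1 j ^ 2 = 1 := S2.sum_sq (x i)
    have hmom := sum_multinomialWeight_mul_exp_sq_le (Nat.lt_of_lt_of_le one_pos hn)
      (p := fun j => (x i).1 j ^ 2) (fun j => sq_nonneg _) hp1
    calc ∑ J ∈ Finset.piAntidiag Finset.univ n,
          (amplitude (D i) (x i) J * Real.exp (1 / 96 * Q i J / 2)) ^ 2 /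
            (Real.exp (-(1 / 96) * Q i J) / B)
        ≤ ∑ J ∈ Finset.piAntidiag Finset.univ n, B * Real.exp (-(1 / 96) * ρ ^ 2) *
          (multinomialWeight (fun j => (x i).1 j ^ 2) J * Real.exp (1 / 32 * Q i J)) := by
          refine Finset.sum_le_sum fun J _ => ?_
          have hw := multinomialWeight_nonneg (p := fun j => (x i).1 j ^ 2)
            (fun j => sq_nonneg _) J
          by_cases hJ : J ∈ D i
          swap
          · simp only [amplitude, hJ, if_false]
            simp only [zero_mul, ne_eq, OfNat.ofNat_ne_zero, not_false_eq_true, zero_pow,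
              zero_div]
            positivity
          obtain ⟨j, hj⟩ := hD i J hJ
          have hQρ : ρ ^ 2 ≤ Q i J := by
            refine (pow_le_pow_left₀ hρ hj 2).trans ?_
            rw [sq_abs]
            exact Finset.single_le_sum (f := fun j => fluctuation n (x i) J j ^ 2)
              (fun j _ => sq_nonneg _) (Finset.mem_univ j)
          simp only [amplitude, hJ, if_true]
          rw [mul_pow, Real.sq_sqrt hw, ← Real.exp_nat_mul, div_div_eq_mul_div,
            mul_div_right_comm, mul_div_assoc, ← Real.exp_sub]
          -- The moment bound allows rate `1/32 = 3/96`. One third pays for the feature norm and one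
          -- for the inverse weight; the last, through `Q ≥ ρ²`, gives the gain `exp(-ρ²/96)`.
          have : Real.exp ((2 : ℕ) * (1 / 96 * Q i J / 2) - -(1 / 96) * Q i J) ≤
              Real.exp (-(1 / 96) * ρ ^ 2) * Real.exp (1 / 32 * Q i J) := by
            rw [← Real.exp_add]
            refine Real.exp_le_exp.2 ?_
            push_cast
            linarith
          calc _ ≤ multinomialWeight (fun j => (x i).1 j ^ 2) J *
                (Real.exp (-(1 / 96) * ρ ^ 2) * Real.exp (1 / 32 * Q i J)) * B := by gcongr
            _ = _ := by ring
      _ ≤ B * Real.exp (-(1 / 96) * ρ ^ 2) * 8 := by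
          rw [← Finset.mul_sum]
          exact mul_le_mul_of_nonneg_left hmom (by positivity)
      _ = _ := by ring

/-- Joint large deviations of the norms of the local vectors at separated points. -/
lemma measure_forall_le_norm_localVector_le {Ω S : Type*} [Fintype S] [MeasurableSpace Ω]
    {μ : Measure Ω} {a : (Fin 3 → ℕ) → Ω → ℝ} (ha : IsIIDStdGaussian μ a) {n : ℕ} (hn : 1 ≤ n)
    (x : S → S2) (D : S → Set (Fin 3 → ℕ)) {B ρ lam : ℝ} (hB : 0 < B)
    (hpack : ∀ J, ∑ i, Real.exp (-(1 / 96) * ∑ j, fluctuation n (x i) J j ^ 2) ≤ B)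
    (hρ : 0 ≤ ρ) (hD : ∀ i, ∀ J ∈ D i, ∃ j, ρ ≤ |fluctuation n (x i) J j|) (hlam : 0 ≤ lam)
    (hlamB : lam * (8 * B * Real.exp (-(1 / 96) * ρ ^ 2)) ≤ 1 / 4) (s : ℝ) :
    μ {ω | ∀ i, s ≤ ‖localVector (1 / 96) n (D i) (x i) fun J => a J ω‖ ^ 2} ≤
      ENNReal.ofReal (2 * Real.exp (-(lam * s))) ^ Fintype.card S := by
  set V : Ω → ℝ := fun ω => ∑ i, ‖localVector (1 / 96) n (D i) (x i) fun J => a J ω‖ ^ 2 with hV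
  have hVm : Measurable V := Finset.measurable_sum _ fun i _ =>
    (measurable_norm_localVector ha.measurable _ _ _ _).pow_const 2
  have h1 : {ω | ∀ i, s ≤ ‖localVector (1 / 96) n (D i) (x i) fun J => a J ω‖ ^ 2} ⊆
      {ω | eexp (lam * (Fintype.card S * s)) ≤ eexp (lam * V ω)} := by
    intro ω hω
    refine eexp_le_eexp (mul_le_mul_of_nonneg_left ?_ hlam)
    calc (Fintype.card S : ℝ) * s = ∑ _i : S, s := by simp
      _ ≤ V ω := Finset.sum_le_sum fun i _ => hω i
  have h2 := mul_meas_ge_le_lintegral (μ := μ) (f := fun ω => eexp (lam * V ω))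
    (hVm.const_mul lam).eexp (eexp (lam * (Fintype.card S * s)))
  have h3 := h2.trans
    (lintegral_eexp_sum_norm_localVector_le ha hn x D hB hpack hρ hD hlam hlamB)
  have h4 : eexp (-(lam * (Fintype.card S * s))) * eexp (lam * (Fintype.card S * s)) = 1 := by
    rw [← eexp_add, neg_add_cancel, eexp_zero]
  calc _ ≤ μ {ω | eexp (lam * (Fintype.card S * s)) ≤ eexp (lam * V ω)} := measure_mono h1
    _ = eexp (-(lam * (Fintype.card S * s))) * (eexp (lam * (Fintype.card S * s)) *
        μ {ω | eexp (lam * (Fintype.card S * s)) ≤ eexp (lam * V ω)}) := by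
        rw [← mul_assoc (eexp _), h4, one_mul]
    _ ≤ eexp (-(lam * (Fintype.card S * s))) * 2 ^ Fintype.card S := by gcongr
    _ = _ := by
        rw [ENNReal.ofReal_mul (by norm_num), mul_pow, mul_comm, ← ENNReal.ofReal_pow
          (Real.exp_pos _).le, ← Real.exp_nat_mul]
        congr 1
        · simp
        · rw [eexp]; congr 2; ring

/-! ### Localised increasing events and independence. -/

/-- Membership depends only on values on `U`, where `h` coincides with `g ⊔ h ≥ g`. -/
lemma IsUpperSet.mem_of_le_on {U : Set S2} {A : Set C(S2, ℝ)} (hA : IsUpperSet A)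
    (hm : MeasurableSet[restrSigma U] A) {g h : C(S2, ℝ)} (hg : g ∈ A)
    (hgh : ∀ x ∈ U, g x ≤ h x) : h ∈ A := by
  obtain ⟨T, -, rfl⟩ := hm
  have h1 := hA (le_sup_left : g ≤ g ⊔ h) hg
  have h2 : (fun x : U => (g ⊔ h) x) = fun x : U => h x :=
    funext fun x => by simpa using hgh x x.2
  rw [Set.mem_preimage] at h1 ⊢
  rwa [← h2]

lemma measurableSet_setOf_mem {α : Type*} [MeasurableSpace α] {U : Set S2} {A : Set C(S2, ℝ)}
    (hm : MeasurableSet[restrSigma U] A) {F : α → C(S2, ℝ)} (hF : ∀ x, Measurable fun c => F c x) :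
    MeasurableSet {c | F c ∈ A} := by
  obtain ⟨T, hT, rfl⟩ := hm
  exact (measurable_pi_iff.2 fun x : U => hF x) hT

/-- Events that depend on disjoint parts of the random polynomial are independent. -/
lemma measureReal_iInter_kostlanPart_mem {Ω : Type*} [MeasurableSpace Ω] {μ : Measure Ω}
    {a : (Fin 3 → ℕ) → Ω → ℝ} (ha : IsIIDStdGaussian μ a) (n : ℕ) {k : ℕ}
    {N : Fin k → Set (Fin 3 → ℕ)} (hN : Pairwise fun i j => Disjoint (N i) (N j))
    {U : Fin k → Set S2} {A : Fin k → Set C(S2, ℝ)} (hA : ∀ i, MeasurableSet[restrSigma (U i)] (A i))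
    (s : ℝ) (S : Finset (Fin k)) :
    μ.real (⋂ i ∈ S, {ω | kostlanPart n (N i) (fun J => a J ω) + ContinuousMap.const S2 s ∈ A i}) =
      ∏ i ∈ S, μ.real {ω | kostlanPart n (N i) (fun J => a J ω) + ContinuousMap.const S2 s ∈ A i} := by
  classical
  -- Only finitely many coefficients enter; extending by zero off a finite set expresses each event
  -- through a finite subfamily.
  let T : Fin k → Finset (Fin 3 → ℕ) := fun i => (Finset.piAntidiag Finset.univ n).filter (· ∈ N i)
  let ext : ∀ W : Finset (Fin 3 → ℕ), (W → ℝ) → (Fin 3 → ℕ) → ℝ :=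
    fun W c J => if h : J ∈ W then c ⟨J, h⟩ else 0
  have hext : ∀ W J, Measurable fun c => ext W c J := by
    intro W J
    by_cases h : J ∈ W
    · simpa [ext, h] using measurable_pi_apply _
    · simp [ext, h]
  let G : ∀ W : Finset (Fin 3 → ℕ), Fin k → Set (W → ℝ) := fun W i =>
    {c | kostlanPart n (N i) (ext W c) + ContinuousMap.const S2 s ∈ A i}
  have hG : ∀ W i, MeasurableSet (G W i) := by
    intro W i
    refine measurableSet_setOf_mem (hA i) fun x => ?_
    simp only [ContinuousMap.add_apply, kostlanPart, kostlan, ContinuousMap.coe_mk,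
      ContinuousMap.const_apply]
    refine Measurable.add_const (Finset.measurable_sum _ fun J _ => ?_) _
    refine Measurable.mul_const (Measurable.const_mul ?_ _) _
    by_cases h : J ∈ N i
    · simpa [h] using hext W J
    · simp [h]
  have hEG : ∀ W i, T i ⊆ W →
      {ω | kostlanPart n (N i) (fun J => a J ω) + ContinuousMap.const S2 s ∈ A i} =
        (fun ω (J : W) => a J ω) ⁻¹' G W i := by
    intro W i hW
    ext ω
    have : kostlanPart n (N i) (fun J => a J ω) =
        kostlanPart n (N i) (ext W fun J : W => a J ω) := by
      ext x
      simp only [kostlanPart, kostlan, ContinuousMap.coe_mk]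
      refine Finset.sum_congr rfl fun J hJ => ?_
      by_cases h : J ∈ N i
      · have hJW : J ∈ W := hW (Finset.mem_filter.2 ⟨hJ, h⟩)
        simp [h, ext, hJW]
      · simp [h]
    simp only [Set.mem_ofPred_eq, Set.mem_preimage, G, this]
  have := ha.indep.isProbabilityMeasure
  induction S using Finset.induction_on with
  | empty => simp
  | insert i S hi ih =>
    have hdisj : Disjoint (T i) (S.biUnion T) := by
      rw [Finset.disjoint_biUnion_right]
      intro j hj
      have hij : i ≠ j := fun h => hi (h ▸ hj)
      exact Finset.disjoint_left.2 fun J hi hj => Set.disjoint_left.1 (hN hij)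
        (Finset.mem_filter.1 hi).2 (Finset.mem_filter.1 hj).2
    have hind := ha.indep.indepFun_finset (T i) (S.biUnion T) hdisj ha.measurable
    have hS : ⋂ j ∈ S,
        {ω | kostlanPart n (N j) (fun J => a J ω) + ContinuousMap.const S2 s ∈ A j} =
          (fun ω (J : S.biUnion T) => a J ω) ⁻¹' ⋂ j ∈ S, G (S.biUnion T) j := by
      rw [Set.preimage_iInter₂]
      exact Set.iInter₂_congr fun j hj => hEG _ j (Finset.subset_biUnion_of_mem T hj)
    rw [Finset.set_biInter_insert, Finset.prod_insert hi, ← ih, hS, hEG (T i) i subset_rfl]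
    simp only [measureReal_def]
    rw [hind.measure_inter_preimage_eq_mul _ _ (hG _ _)
      (Finset.measurableSet_biInter _ fun j _ => hG _ j), ENNReal.toReal_mul]

/-! ### Decoupling of sandwiched events. -/

/-- Factors are replaced one at a time; each replacement costs at most `q` since the others are at
most one. -/
lemma prod_le_prod_add_card_mul {ι : Type*} (S : Finset ι) {e p : ι → ℝ} {q : ℝ} (hq : 0 ≤ q)
    (he0 : ∀ i ∈ S, 0 ≤ e i) (he1 : ∀ i ∈ S, e i ≤ 1) (hp0 : ∀ i ∈ S, 0 ≤ p i)
    (hp1 : ∀ i ∈ S, p i ≤ 1) (hep : ∀ i ∈ S, e i ≤ p i + q) :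
    ∏ i ∈ S, e i ≤ ∏ i ∈ S, p i + S.card * q := by
  classical
  induction S using Finset.induction_on with
  | empty => simp
  | insert i S hi ih =>
    simp only [Finset.forall_mem_insert] at he0 he1 hp0 hp1 hep
    have h := ih he0.2 he1.2 hp0.2 hp1.2 hep.2
    rw [Finset.prod_insert hi, Finset.prod_insert hi, Finset.card_insert_of_notMem hi]
    have hP0 : 0 ≤ ∏ j ∈ S, p j := Finset.prod_nonneg hp0.2
    have hP1 : ∏ j ∈ S, p j ≤ 1 := Finset.prod_le_one hp0.2 hp1.2
    have hcq : 0 ≤ (S.card : ℝ) * q := by positivity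
    push_cast
    nlinarith [mul_le_mul_of_nonneg_left h he0.1, mul_le_mul_of_nonneg_right hep.1 hP0,
      mul_le_mul_of_nonneg_right he1.1 hcq, mul_le_mul_of_nonneg_left hP1 hq]

/-- Decoupling of events that are, up to rare exceptional events, sandwiched by independent ones:
bound by the product of the probabilities. -/
lemma measureReal_iInter_le_prod_add {Ω : Type*} [MeasurableSpace Ω] {μ : Measure Ω}
    [IsProbabilityMeasure μ] {k : ℕ} {F E P V : Fin k → Set Ω} (hF : ∀ i, F i ⊆ E i ∪ V i)
    (hE : ∀ i, E i ⊆ P i ∪ V i)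
    (hind : ∀ S : Finset (Fin k), μ.real (⋂ i ∈ S, E i) = ∏ i ∈ S, μ.real (E i)) {q : ℝ}
    (hq : 0 ≤ q) (hV : ∀ S : Finset (Fin k), μ.real (⋂ i ∈ S, V i) ≤ q ^ S.card) :
    μ.real (⋂ i, F i) ≤ ∏ i, μ.real (P i) + 2 * k * q := by
  have hV1 : ∀ i, μ.real (V i) ≤ q := fun i => by simpa using hV {i}
  have h1 : ⋂ i, F i ⊆ (⋂ i ∈ (Finset.univ : Finset (Fin k)), E i) ∪ ⋃ i, V i := by
    intro ω hω
    by_cases h : ∃ i, ω ∈ V i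
    · exact Or.inr (Set.mem_iUnion.2 h)
    · push Not at h
      refine Or.inl (Set.mem_iInter₂.2 fun i _ => ?_)
      exact (hF i (Set.mem_iInter.1 hω i)).resolve_right (h i)
  have h2 : μ.real (⋃ i, V i) ≤ k * q := by
    refine (measureReal_iUnion_fintype_le _).trans
      ((Finset.sum_le_sum fun i _ => hV1 i).trans (by simp))
  have h3 : ∏ i, μ.real (E i) ≤ ∏ i, μ.real (P i) + (Finset.univ : Finset (Fin k)).card * q :=
    prod_le_prod_add_card_mul _ hq (fun _ _ => measureReal_nonneg)
      (fun _ _ => measureReal_le_one) (fun _ _ => measureReal_nonneg)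
      (fun _ _ => measureReal_le_one) fun i _ =>
        (measureReal_mono (hE i)).trans ((measureReal_union_le _ _).trans (by gcongr; exact hV1 i))
  have h4 := (measureReal_mono h1 (μ := μ)).trans (measureReal_union_le _ _)
  rw [hind] at h4
  simp only [Finset.card_univ, Fintype.card_fin] at h3
  linarith

/-- Decoupling of events that are, up to rare exceptional events, sandwiched by independent ones:
exponential bound in the number of events. -/
lemma measureReal_iInter_le_rpow_add {Ω : Type*} [MeasurableSpace Ω] {μ : Measure Ω}
    [IsProbabilityMeasure μ] {k : ℕ} {F E P V : Fin k → Set Ω} (hF : ∀ i, F i ⊆ E i ∪ V i)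
    (hE : ∀ i, E i ⊆ P i ∪ V i)
    (hind : ∀ S : Finset (Fin k), μ.real (⋂ i ∈ S, E i) = ∏ i ∈ S, μ.real (E i)) {p q : ℝ}
    (hq : 0 < q) (hq1 : q ≤ 1) (hV : ∀ S : Finset (Fin k), μ.real (⋂ i ∈ S, V i) ≤ q ^ S.card)
    (hp : 0 ≤ p) (hP : ∀ i, μ.real (P i) ≤ p) :
    μ.real (⋂ i, F i) ≤ (8 * p) ^ ((k : ℝ) / 2) + 2 * (8 * q) ^ ((k : ℝ) / 2) := by
  classical
  have hV1 : ∀ i, μ.real (V i) ≤ q := fun i => by simpa using hV {i}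
  set κ : ℝ := (k : ℝ) / 2 with hκ
  have hκ0 : 0 ≤ κ := by positivity
  -- Truncation at one makes powers of `m` decrease in the exponent, so sets of size at least `k/2`
  -- are all bounded by `m ^ (k/2)`.
  set m := min 1 (p + q) with hm
  have hm0 : 0 < m := lt_min one_pos (by linarith)
  have hEm : ∀ i, μ.real (E i) ≤ m := fun i => le_min measureReal_le_one
    ((measureReal_mono (hE i)).trans ((measureReal_union_le _ _).trans (add_le_add (hP i) (hV1 i))))
  -- Either the indices in `V` or their complement form such a set. There are at most `2^k =
  -- 4^(k/2)` of them, and `8 = 4 · 2` with `m ≤ 2 max p q`.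
  let L : Finset (Finset (Fin k)) := Finset.univ.filter fun S => k ≤ 2 * S.card
  have h1 : ⋂ i, F i ⊆ ⋃ S ∈ L, ((⋂ i ∈ S, E i) ∪ ⋂ i ∈ S, V i) := by
    intro ω hω
    set S : Finset (Fin k) := Finset.univ.filter fun i => ω ∈ V i with hS
    have hcard : S.card + Sᶜ.card = k := by simp
    rw [Set.mem_iUnion₂]
    rcases le_total k (2 * S.card) with h | h
    · refine ⟨S, Finset.mem_filter.2 ⟨Finset.mem_univ _, h⟩, Or.inr ?_⟩
      exact Set.mem_iInter₂.2 fun i hi => (Finset.mem_filter.1 hi).2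
    · refine ⟨Sᶜ, Finset.mem_filter.2 ⟨Finset.mem_univ _, by omega⟩, Or.inl ?_⟩
      refine Set.mem_iInter₂.2 fun i hi => ?_
      refine (hF i (Set.mem_iInter.1 hω i)).resolve_right fun hV => ?_
      exact Finset.mem_compl.1 hi (Finset.mem_filter.2 ⟨Finset.mem_univ _, hV⟩)
  have hpow : ∀ b : ℝ, 0 < b → b ≤ 1 → ∀ S ∈ L, b ^ S.card ≤ b ^ κ := by
    intro b hb hb1 S hS
    rw [← Real.rpow_natCast]
    refine Real.rpow_le_rpow_of_exponent_ge hb hb1 ?_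
    have : (k : ℝ) ≤ 2 * S.card := by exact_mod_cast (Finset.mem_filter.1 hS).2
    rw [hκ]; linarith
  have h2 : ∀ S ∈ L, μ.real ((⋂ i ∈ S, E i) ∪ ⋂ i ∈ S, V i) ≤ m ^ κ + q ^ κ := by
    intro S hS
    refine (measureReal_union_le _ _).trans (add_le_add ?_ ((hV S).trans (hpow q hq hq1 S hS)))
    rw [hind]
    refine (Finset.prod_le_prod (fun _ _ => measureReal_nonneg) fun i _ => hEm i).trans ?_
    rw [Finset.prod_const]
    exact hpow m hm0 (min_le_left _ _) S hS
  have hL : (L.card : ℝ) ≤ 4 ^ κ := by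
    have h3 : L.card ≤ 2 ^ k := (Finset.card_le_univ _).trans (by simp)
    have h4 : (4 : ℝ) ^ κ = 2 ^ k := by
      rw [show (4 : ℝ) = 2 ^ (2 : ℝ) by norm_num, ← Real.rpow_mul (by norm_num), hκ,
        mul_div_cancel₀ _ two_ne_zero, Real.rpow_natCast]
    rw [h4]; exact_mod_cast h3
  have h3 : m ^ κ ≤ (2 * p) ^ κ + (2 * q) ^ κ := by
    rcases le_total p q with h | h
    · have := Real.rpow_le_rpow hm0.le ((min_le_right 1 (p + q)).trans
        (by linarith : p + q ≤ 2 * q)) hκ0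
      have := Real.rpow_nonneg (by linarith : 0 ≤ 2 * p) κ
      linarith
    · have := Real.rpow_le_rpow hm0.le ((min_le_right 1 (p + q)).trans
        (by linarith : p + q ≤ 2 * p)) hκ0
      have := Real.rpow_nonneg (by linarith : 0 ≤ 2 * q) κ
      linarith
  have h8 : ∀ b : ℝ, 0 ≤ b → 4 ^ κ * (2 * b) ^ κ = (8 * b) ^ κ := fun b hb => by
    rw [← Real.mul_rpow (by norm_num) (by positivity)]; congr 1; ring
  have h5 : q ^ κ ≤ (2 * q) ^ κ := Real.rpow_le_rpow hq.le (by linarith) hκ0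
  calc μ.real (⋂ i, F i) ≤ ∑ S ∈ L, μ.real ((⋂ i ∈ S, E i) ∪ ⋂ i ∈ S, V i) :=
        (measureReal_mono h1 (measure_ne_top _ _)).trans (measureReal_biUnion_finset_le _ _)
    _ ≤ ∑ _S ∈ L, (m ^ κ + q ^ κ) := Finset.sum_le_sum h2
    _ = L.card * (m ^ κ + q ^ κ) := by rw [Finset.sum_const, nsmul_eq_mul]
    _ ≤ 4 ^ κ * ((2 * p) ^ κ + (2 * q) ^ κ + (2 * q) ^ κ) := by
        have := Real.rpow_nonneg hm0.le κ
        have := Real.rpow_nonneg hq.le κ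
        gcongr
    _ = (8 * p) ^ κ + 2 * (8 * q) ^ κ := by
        rw [← h8 p hp, ← h8 q hq.le]; ring

/-! ### Approximation by independent parts. -/

lemma exists_pos_le_coord {𝒰 : Set S2} (h𝒰 : IsCompact 𝒰) (h𝒰O : 𝒰 ⊆ posOrthant) :
    ∃ δ > 0, ∀ x ∈ 𝒰, ∀ j, δ ≤ x.1 j := by
  have h : ∀ j : Fin 3, ∃ δ > 0, ∀ x ∈ 𝒰, δ ≤ x.1 j := by
    intro j
    rcases 𝒰.eq_empty_or_nonempty with rfl | hne
    · exact ⟨1, one_pos, by simp⟩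
    · obtain ⟨x, hx, hmin⟩ := h𝒰.exists_isMinOn hne
        (f := fun x : S2 => x.1 j) (Continuous.continuousOn (by fun_prop))
      exact ⟨x.1 j, h𝒰O hx j, fun y hy => hmin hy⟩
  choose δ hδ hle using h
  refine ⟨min (δ 0) (min (δ 1) (δ 2)), lt_min (hδ 0) (lt_min (hδ 1) (hδ 2)), fun x hx j => ?_⟩
  refine le_trans ?_ (hle j x hx)
  fin_cases j <;> simp

/-- The random polynomial is approximated on well-separated sets by independent parts of it, with a
large deviation bound for the joint failure of the approximation. -/
lemma exists_independent_approximation {δ : ℝ} (hδ : 0 < δ) :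
    ∃ γ c : ℝ, 0 < γ ∧ 0 < c ∧ ∀ (n : ℕ), 1 ≤ n → ∀ r u : ℝ, 1 / √(n : ℝ) ≤ r →
      1 / √(n : ℝ) ≤ u → ∀ (Ω : Type*) [MeasurableSpace Ω] (μ : Measure Ω) [IsProbabilityMeasure μ]
      (a : (Fin 3 → ℕ) → Ω → ℝ), IsIIDStdGaussian μ a → ∀ (k : ℕ) (U : Fin k → Set S2),
      (∀ i, ∀ x ∈ U i, ∀ j, δ ≤ x.1 j) → (∀ i, ∃ x, U i ⊆ sphCap x u) →
      (∀ i j, i ≠ j → ∀ x ∈ U i, ∀ y ∈ U j, r ≤ sphDist x y) → ∀ t : ℝ, 0 ≤ t →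
      ∃ (N : Fin k → Set (Fin 3 → ℕ)) (V : Fin k → Set Ω),
        (Pairwise fun i j => Disjoint (N i) (N j)) ∧
        (∀ i, ∀ ω ∉ V i, ∀ x ∈ U i, |kostlanPart n (N i)ᶜ (fun J => a J ω) x| ≤ t / 2) ∧
        ∀ S : Finset (Fin k), μ.real (⋂ i ∈ S, V i) ≤
          (2 * (2 * u * √(n : ℝ)) ^ 6 * Real.exp (-(γ * (t ^ 2 * Real.exp (c * r ^ 2 * n))))) ^
            S.card := by
  classical
  obtain ⟨B, hB, hpack⟩ := exists_packing_bound (κ := 1 / 96) (h := δ / 2) (by norm_num)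
    (by positivity)
  set C := Real.exp (3 / (2 * (1 / 96) * δ ^ 2)) with hC
  have hC0 : 0 < C := Real.exp_pos _
  refine ⟨1 / (32 * B) * (1 / (4 * C ^ 2)), δ ^ 2 / (16 * 96), by positivity, by positivity, ?_⟩
  intro n hn r u hr hu Ω _ μ _ a ha k U hUδ hUcap hsep t ht
  have hn' : (0 : ℝ) < n := by exact_mod_cast hn
  have hs : 0 < √(n : ℝ) := Real.sqrt_pos.2 hn'
  have hss : √(n : ℝ) * √(n : ℝ) = n := Real.mul_self_sqrt hn'.le
  have hr0 : 0 < r := (by positivity : 0 < 1 / √(n : ℝ)).trans_le hr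
  have hsepsq : ∀ i j, i ≠ j → ∀ x ∈ U i, ∀ y ∈ U j, ∃ l, δ / 2 * r < |x.1 l ^ 2 - y.1 l ^ 2| :=
    fun i j hij x hx y hy =>
      exists_sq_sub_gt_of_le_sphDist hδ hr0 (hUδ i x hx) (hUδ j y hy) (hsep i j hij x hx y hy)
  choose ctr hctr using hUcap
  choose X hXU hXcard hXnet using fun i => exists_net hn hu (hctr i)
  -- The radius is half the separation `δ/2 · r` of the squared coordinates, which makes these sets
  -- disjoint; an index outside fluctuates by at least `δ/4 · r√n` at every point of `U i`.
  let N : Fin k → Set (Fin 3 → ℕ) := fun i =>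
    {J | ∃ x ∈ U i, ∀ l, |(J l : ℝ) - n * x.1 l ^ 2| ≤ δ / 4 * r * n}
  -- Chosen so that a squared norm below `s` gives `C * ‖·‖ ≤ t/2`.
  set s : ℝ := t ^ 2 / (4 * C ^ 2) with hsdef
  let V : Fin k → Set Ω := fun i =>
    {ω | ∃ x ∈ X i, s ≤ ‖localVector (1 / 96) n (N i)ᶜ x fun J => a J ω‖ ^ 2}
  refine ⟨N, V, ?_, ?_, ?_⟩
  · intro i j hij
    refine Set.disjoint_left.2 ?_
    rintro J ⟨x, hx, hxJ⟩ ⟨y, hy, hyJ⟩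
    obtain ⟨l, hl⟩ := hsepsq i j hij x hx y hy
    have h1 : |(n : ℝ) * x.1 l ^ 2 - n * y.1 l ^ 2| ≤ δ / 2 * r * n := by
      have h2 := abs_sub_le (n * x.1 l ^ 2) (J l : ℝ) (n * y.1 l ^ 2)
      rw [abs_sub_comm (_ : ℝ) (J l : ℝ)] at h2
      linarith [hxJ l, hyJ l]
    rw [← mul_sub, abs_mul, abs_of_pos hn'] at h1
    nlinarith
  · intro i ω hω x hx
    obtain ⟨x₀, hx₀, hnear⟩ := hXnet i x hx
    have h1 := abs_kostlanPart_le (κ := 1 / 96) (by norm_num) hδ hn (N i)ᶜ (fun J => a J ω)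
      (hUδ i x hx) (hUδ i x₀ (hXU i x₀ hx₀)) hnear
    rw [← hC] at h1
    refine h1.trans (abs_le_of_sq_le_sq' ?_ (by positivity)).2
    have h2 : ‖localVector (1 / 96) n (N i)ᶜ x₀ fun J => a J ω‖ ^ 2 < s := by
      by_contra! h
      exact hω ⟨x₀, hx₀, h⟩
    rw [hsdef, lt_div_iff₀ (by positivity)] at h2
    rw [mul_pow]
    linarith
  · intro S
    -- The largest admissible value: `lam * 8B * exp(-ρ²/96) = 1/4`.
    set lam : ℝ := Real.exp (δ ^ 2 / (16 * 96) * r ^ 2 * n) / (32 * B) with hlam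
    set ρ : ℝ := δ / 4 * r * √(n : ℝ) with hρ
    have hρsq : ρ ^ 2 = δ ^ 2 / 16 * r ^ 2 * n := by
      rw [hρ, mul_pow, Real.sq_sqrt hn'.le]; ring
    have hdev : ∀ ξ ∈ Fintype.piFinset fun i : S => X i,
        μ.real {ω | ∀ i : S, s ≤ ‖localVector (1 / 96) n (N i)ᶜ (ξ i) fun J => a J ω‖ ^ 2} ≤
          (2 * Real.exp (-(lam * s))) ^ S.card := by
      intro ξ hξ
      have hξU : ∀ i : S, ξ i ∈ U i := fun i => hXU i _ (Fintype.mem_piFinset.1 hξ i)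
      have h := measure_forall_le_norm_localVector_le ha hn ξ (fun i => (N i)ᶜ) (ρ := ρ)
        (lam := lam) hB ?_ (by positivity) ?_ (by positivity) ?_ s
      · rw [← ENNReal.ofReal_pow (by positivity), Fintype.card_coe] at h
        exact ENNReal.toReal_le_of_le_ofReal (by positivity) h
      · intro J
        have := hpack (fun (i : S) j => √(n : ℝ) * (ξ i).1 j ^ 2) ?_ fun j => J j / √(n : ℝ)
        · refine le_trans (le_of_eq ?_) this
          refine Finset.sum_congr rfl fun i _ => ?_
          congr 2
          refine Finset.sum_congr rfl fun j _ => ?_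
          rw [fluctuation, sub_div]
          congr 2
          rw [div_eq_iff hs.ne']
          linear_combination -(ξ i).1 j ^ 2 * hss
        -- Some rescaled squared coordinate differs by more than `δ/2 · r√n ≥ δ/2`, the packing
        -- mesh, so the integer parts differ. This uses `r ≥ 1/√n`.
        · intro i i' hii
          by_contra hne
          obtain ⟨l, hl⟩ := hsepsq i i' (fun h => hne (Subtype.ext h)) _ (hξU i) _ (hξU i')
          have h1 := Int.abs_sub_lt_one_of_floor_eq_floor (congrFun hii l)
          rw [← sub_div, ← mul_sub, abs_div, abs_mul, abs_of_pos hs,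
            abs_of_pos (by positivity : 0 < δ / 2), div_lt_one (by positivity)] at h1
          rw [div_le_iff₀ hs] at hr
          nlinarith [mul_lt_mul_of_pos_right hl hs,
            mul_le_mul_of_nonneg_left hr (half_pos hδ).le]
      · intro i J hJ
        have h1 : ¬ ∀ l, |(J l : ℝ) - n * (ξ i).1 l ^ 2| ≤ δ / 4 * r * n :=
          fun h => hJ ⟨ξ i, hξU i, h⟩
        push Not at h1
        obtain ⟨l, hl⟩ := h1
        refine ⟨l, ?_⟩
        rw [fluctuation, abs_div, abs_of_pos hs, le_div_iff₀ hs, hρ, mul_assoc, hss]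
        exact hl.le
      · rw [hρsq, hlam]
        have : Real.exp (δ ^ 2 / (16 * 96) * r ^ 2 * n) *
            Real.exp (-(1 / 96) * (δ ^ 2 / 16 * r ^ 2 * n)) = 1 := by
          rw [← Real.exp_add]; exact Real.exp_eq_one_iff _ |>.2 (by ring)
        refine le_of_eq ?_
        field_simp at this ⊢
        linarith
    -- Union bound over all choices of one net point per index; the net sizes multiply, so the bound
    -- keeps its form of an `S.card`-th power.
    have hsub : ⋂ i ∈ S, V i ⊆ ⋃ ξ ∈ Fintype.piFinset fun i : S => X i,
        {ω | ∀ i : S, s ≤ ‖localVector (1 / 96) n (N i)ᶜ (ξ i) fun J => a J ω‖ ^ 2} := by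
      intro ω hω
      have h1 : ∀ i : S, ∃ x ∈ X i, s ≤ ‖localVector (1 / 96) n (N i)ᶜ x fun J => a J ω‖ ^ 2 :=
        fun i => Set.mem_iInter₂.1 hω i i.2
      choose ξ hξ hξs using h1
      exact Set.mem_iUnion₂.2 ⟨ξ, Fintype.mem_piFinset.2 hξ, hξs⟩
    have hcard : ((Fintype.piFinset fun i : S => X i).card : ℝ) ≤
        ((2 * u * √(n : ℝ)) ^ 6) ^ S.card := by
      rw [Fintype.card_piFinset]
      push_cast
      refine (Finset.prod_le_prod (fun _ _ => Nat.cast_nonneg _) fun i _ => hXcard i.1).trans ?_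
      simp
    calc μ.real (⋂ i ∈ S, V i)
        ≤ ∑ ξ ∈ Fintype.piFinset fun i : S => X i, μ.real
          {ω | ∀ i : S, s ≤ ‖localVector (1 / 96) n (N i)ᶜ (ξ i) fun J => a J ω‖ ^ 2} :=
          (measureReal_mono hsub (measure_ne_top _ _)).trans (measureReal_biUnion_finset_le _ _)
      _ ≤ ∑ _ξ ∈ Fintype.piFinset fun i : S => X i, (2 * Real.exp (-(lam * s))) ^ S.card :=
          Finset.sum_le_sum hdev
      _ = (Fintype.piFinset fun i : S => X i).card * (2 * Real.exp (-(lam * s))) ^ S.card := by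
          simp only [Finset.sum_const, nsmul_eq_mul]
      _ ≤ ((2 * u * √(n : ℝ)) ^ 6) ^ S.card * (2 * Real.exp (-(lam * s))) ^ S.card := by gcongr
      _ = _ := by
          rw [← mul_pow]
          congr 1
          have : lam * s = 1 / (32 * B) * (1 / (4 * C ^ 2)) *
              (t ^ 2 * Real.exp (δ ^ 2 / (16 * 96) * r ^ 2 * n)) := by
            rw [hlam, hsdef]; field_simp
          rw [this]; ring

/-! ### Choice of constants and conclusion. -/

/-- The threshold on `t` makes half of the exponent pay for the net: six powers of `M` for its size
and one for the factor `2 ≤ M`. Squaring the threshold doubles its decay rate, hence `c₂ ≤ c/2`. -/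
lemma log_le_of_threshold_le {γ c c₂ r M t : ℝ} {n : ℕ} (hγ : 0 < γ) (hc₂c : c₂ ≤ c / 2)
    (hlogM : 0 ≤ Real.log M)
    (ht : (8 + 14 / γ) * √(Real.log M) * Real.exp (-c₂ * r ^ 2 * n) ≤ t) :
    7 * Real.log M ≤ γ / 2 * (t ^ 2 * Real.exp (c * r ^ 2 * n)) := by
  have hγinv : 0 < 14 / γ := by positivity
  have h1 : (8 + 14 / γ) ^ 2 * Real.log M * Real.exp (-c₂ * r ^ 2 * n) ^ 2 ≤ t ^ 2 := by
    have := pow_le_pow_left₀ (by positivity) ht 2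
    rwa [mul_pow, mul_pow, Real.sq_sqrt hlogM] at this
  have h2 : 1 ≤ Real.exp (-c₂ * r ^ 2 * n) ^ 2 * Real.exp (c * r ^ 2 * n) := by
    rw [← Real.exp_nat_mul, ← Real.exp_add]
    refine Real.one_le_exp ?_
    push_cast
    have : 0 ≤ r ^ 2 * (n : ℝ) := by positivity
    nlinarith
  have h3 : 14 / γ ≤ (8 + 14 / γ) ^ 2 := by nlinarith
  have h4 : 14 / γ * Real.log M ≤ t ^ 2 * Real.exp (c * r ^ 2 * n) := by
    calc 14 / γ * Real.log M ≤ (8 + 14 / γ) ^ 2 * Real.log M * 1 := by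
          rw [mul_one]; gcongr
      _ ≤ (8 + 14 / γ) ^ 2 * Real.log M *
          (Real.exp (-c₂ * r ^ 2 * n) ^ 2 * Real.exp (c * r ^ 2 * n)) := by gcongr
      _ = (8 + 14 / γ) ^ 2 * Real.log M * Real.exp (-c₂ * r ^ 2 * n) ^ 2 *
          Real.exp (c * r ^ 2 * n) := by ring
      _ ≤ t ^ 2 * Real.exp (c * r ^ 2 * n) := by gcongr
  calc 7 * Real.log M = γ / 2 * (14 / γ * Real.log M) := by field_simp; ring
    _ ≤ _ := by gcongr

lemma exp_neg_le_of_log_le {γ T M : ℝ} (hM2 : 2 ≤ M) (hTM : 7 * Real.log M ≤ γ / 2 * T) :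
    Real.exp (-(γ / 2 * T)) ≤ 1 / 64 ∧
      2 * M ^ 6 * Real.exp (-(γ * T)) ≤ Real.exp (-(γ / 2 * T)) := by
  set q := Real.exp (-(γ / 2 * T)) with hq
  have hq0 : 0 < q := Real.exp_pos _
  have hqM : q * M ^ 7 ≤ 1 := by
    rw [hq, ← Real.exp_log (by positivity : 0 < M ^ 7), Real.log_pow, ← Real.exp_add]
    refine Real.exp_le_one_iff.2 ?_
    push_cast
    linarith
  have hM7 : (2 : ℝ) ^ 7 ≤ M ^ 7 := pow_le_pow_left₀ (by norm_num) hM2 7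
  refine ⟨by nlinarith, ?_⟩
  have h1 : Real.exp (-(γ * T)) = q * q := by
    rw [hq, ← Real.exp_add]; congr 1; ring
  rw [h1]
  calc 2 * M ^ 6 * (q * q) ≤ M * M ^ 6 * (q * q) := by gcongr
    _ = q * M ^ 7 * q := by ring
    _ ≤ 1 * q := by gcongr
    _ = q := one_mul q

/-- With `q` the exponential, `q ≤ 1/64` means `8q ≤ √q`: the factor `8` is absorbed by half of the
exponent. The power `k/2` halves it again, hence `γ/8`. -/
lemma rpow_exp_neg_le {γ T T' c₂ : ℝ} (hγ : 0 < γ) (hc₂γ : c₂ ≤ γ / 8)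
    (hT' : 0 ≤ T') (hTT' : T' ≤ T) (hq : Real.exp (-(γ / 2 * T)) ≤ 1 / 64) (k : ℕ) :
    (8 * Real.exp (-(γ / 2 * T))) ^ ((k : ℝ) / 2) ≤ Real.exp (-(k * (c₂ * T'))) := by
  have h2 : Real.exp (-(γ / 2 * T)) = Real.exp (-(γ / 4 * T)) ^ 2 := by
    rw [← Real.exp_nat_mul]; congr 1; push_cast; ring
  have h1 : 8 * Real.exp (-(γ / 2 * T)) ≤ Real.exp (-(γ / 4 * T)) := by
    have h3 := Real.exp_pos (-(γ / 4 * T))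
    have h4 : Real.exp (-(γ / 4 * T)) ≤ 1 / 8 := by
      refine le_of_sq_le_sq ?_ (by norm_num)
      rw [← h2]; linarith
    rw [h2]; nlinarith
  refine (Real.rpow_le_rpow (by positivity) h1 (by positivity)).trans ?_
  rw [← Real.exp_mul]
  refine Real.exp_le_exp.2 ?_
  have h3 : c₂ * T' ≤ γ / 8 * T := by gcongr
  linarith [mul_le_mul_of_nonneg_left h3 (Nat.cast_nonneg k : (0 : ℝ) ≤ k)]

theorem proposition3p9 (𝒰 : Set S2) (h𝒰 : IsCompact 𝒰) (h𝒰O : 𝒰 ⊆ posOrthant) :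
    ∃ c₁ c₂ : ℝ, 0 < c₁ ∧ 0 < c₂ ∧
      ∀ (n : ℕ), 1 ≤ n →
      ∀ (r u : ℝ), r ∈ Set.Icc 0 Real.pi → u ∈ Set.Icc 0 Real.pi →
        1 / √(n : ℝ) ≤ r → 1 / √(n : ℝ) ≤ u →
      ∀ (Ω : Type*) [MeasurableSpace Ω] (μ : Measure Ω) [IsProbabilityMeasure μ]
        (a : (Fin 3 → ℕ) → Ω → ℝ), IsIIDStdGaussian μ a →
      ∀ (k : ℕ) (A : Fin k → Set C(S2, ℝ)), InClassE 𝒰 r u A →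
      ∀ t : ℝ, c₁ * √(Real.log (2 * u * √(n : ℝ))) * Real.exp (-c₂ * r ^ 2 * n) ≤ t →
        (μ.real {ω | ∀ i, kostlan n (fun J => a J ω) ∈ A i} ≤
            (∏ i, μ.real {ω | kostlan n (fun J => a J ω) + ContinuousMap.const S2 t ∈ A i}) +
              c₁ * k * Real.exp (-c₂ * t ^ 2 * Real.exp (c₂ * r ^ 2 * n))) ∧
        (μ.real {ω | ∀ i, kostlan n (fun J => a J ω) ∈ A i} ≤
            (c₁ * ⨆ i, μ.real {ω | kostlan n (fun J => a J ω) +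
                ContinuousMap.const S2 t ∈ A i}) ^ (c₂ * (k : ℝ)) +
              c₁ * Real.exp (-c₂ * k * t ^ 2 * Real.exp (c₂ * r ^ 2 * n))) := by
  obtain ⟨δ, hδ, hδ𝒰⟩ := exists_pos_le_coord h𝒰 h𝒰O
  obtain ⟨γ, c, hγ, hc, happrox⟩ := exists_independent_approximation hδ
  obtain ⟨c₂, hc₂, hc₂c, hc₂γ, hc₂1⟩ : ∃ c₂ : ℝ, 0 < c₂ ∧ c₂ ≤ c / 2 ∧ c₂ ≤ γ / 8 ∧ c₂ ≤ 1 / 2 :=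
    ⟨min (c / 2) (min (γ / 8) (1 / 2)), by positivity, min_le_left _ _,
      (min_le_right _ _).trans (min_le_left _ _), (min_le_right _ _).trans (min_le_right _ _)⟩
  have hγinv : 0 < 14 / γ := by positivity
  -- The `8` covers the factor of `p` and the prefactors `2` of the error terms; `14/γ` serves the
  -- threshold on `t`.
  refine ⟨8 + 14 / γ, c₂, by positivity, hc₂, ?_⟩
  intro n hn r u _ _ hr hu Ω _ μ _ a ha k A hA t ht
  obtain ⟨U, hU, hsep⟩ := hA.localized
  have hn' : (0 : ℝ) < n := by exact_mod_cast hn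
  have hs : 0 < √(n : ℝ) := Real.sqrt_pos.2 hn'
  set M := 2 * u * √(n : ℝ) with hM
  have hM2 : 2 ≤ M := by
    rw [div_le_iff₀ hs] at hu; linarith
  have hlogM : 0 ≤ Real.log M := Real.log_nonneg (by linarith)
  have ht0 : 0 ≤ t := le_trans (by positivity) ht
  obtain ⟨N, V, hN, hVapp, hVdev⟩ := happrox n hn r u hr hu Ω μ a ha k U
    (fun i x hx => hδ𝒰 x ((hU i).2.1 hx)) (fun i => (hU i).2.2.2) hsep t ht0
  set T := t ^ 2 * Real.exp (c * r ^ 2 * n) with hT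
  have hT0 : 0 ≤ T := by positivity
  have hTM : 7 * Real.log M ≤ γ / 2 * T := log_le_of_threshold_le hγ hc₂c hlogM ht
  set q := Real.exp (-(γ / 2 * T)) with hq
  have hq0 : 0 < q := Real.exp_pos _
  obtain ⟨hq64, hqM⟩ := exp_neg_le_of_log_le hM2 hTM
  have hdev : ∀ S : Finset (Fin k), μ.real (⋂ i ∈ S, V i) ≤ q ^ S.card := by
    intro S
    exact (hVdev S).trans (pow_le_pow_left₀ (by positivity) hqM _)
  have hsplit := fun i ω x => kostlanPart_add_compl n (N i) (fun J => a J ω) x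
  have hF : ∀ i, {ω | kostlan n (fun J => a J ω) ∈ A i} ⊆
      {ω | kostlanPart n (N i) (fun J => a J ω) + ContinuousMap.const S2 (t / 2) ∈ A i} ∪ V i := by
    intro i ω hω
    by_cases hV : ω ∈ V i
    · exact Or.inr hV
    refine Or.inl ((hA.increasing i).mem_of_le_on (hU i).2.2.1 hω fun x hx => ?_)
    have := abs_le.1 (hVapp i ω hV x hx)
    simp only [ContinuousMap.add_apply, ContinuousMap.const_apply]
    linarith [hsplit i ω x]
  have hE : ∀ i, {ω | kostlanPart n (N i) (fun J => a J ω) + ContinuousMap.const S2 (t / 2) ∈ A i} ⊆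
      {ω | kostlan n (fun J => a J ω) + ContinuousMap.const S2 t ∈ A i} ∪ V i := by
    intro i ω hω
    by_cases hV : ω ∈ V i
    · exact Or.inr hV
    refine Or.inl ((hA.increasing i).mem_of_le_on (hU i).2.2.1 hω fun x hx => ?_)
    have := abs_le.1 (hVapp i ω hV x hx)
    simp only [ContinuousMap.add_apply, ContinuousMap.const_apply]
    linarith [hsplit i ω x]
  have hind := measureReal_iInter_kostlanPart_mem ha n hN (fun i => (hU i).2.2.1) (t / 2)
  have hexp : t ^ 2 * Real.exp (c₂ * r ^ 2 * n) ≤ T := by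
    rw [hT]
    gcongr
    linarith
  have hexp0 : 0 ≤ t ^ 2 * Real.exp (c₂ * r ^ 2 * n) := by positivity
  have hset : {ω | ∀ i, kostlan n (fun J => a J ω) ∈ A i} =
      ⋂ i, {ω | kostlan n (fun J => a J ω) ∈ A i} := by
    ext ω; simp
  rw [hset]
  constructor
  · refine (measureReal_iInter_le_prod_add hF hE hind hq0.le hdev).trans ?_
    gcongr
    · linarith
    · rw [hq]
      refine Real.exp_le_exp.2 ?_
      nlinarith
  · set p := ⨆ i, μ.real {ω | kostlan n (fun J => a J ω) + ContinuousMap.const S2 t ∈ A i} with hp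
    have hp0 : 0 ≤ p := Real.iSup_nonneg fun _ => measureReal_nonneg
    have hpi : ∀ i, μ.real {ω | kostlan n (fun J => a J ω) + ContinuousMap.const S2 t ∈ A i} ≤ p :=
      fun i => le_ciSup (f := fun i =>
        μ.real {ω | kostlan n (fun J => a J ω) + ContinuousMap.const S2 t ∈ A i})
        (Set.finite_range _).bddAbove i
    have hk0 : (0 : ℝ) ≤ k := Nat.cast_nonneg k
    have hck : 0 ≤ c₂ * (k : ℝ) := by positivity
    -- If `8p ≤ 1`, lowering the exponent from `k/2` to `c₂ k` only increases the power. Otherwise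
    -- the right-hand side is at least one.
    rcases le_or_gt (8 * p) 1 with h8 | h8
    · refine (measureReal_iInter_le_rpow_add hF hE hind hq0 (by linarith) hdev hp0
        hpi).trans (add_le_add ?_ ?_)
      · calc (8 * p) ^ ((k : ℝ) / 2) ≤ (8 * p) ^ (c₂ * (k : ℝ)) :=
              Real.rpow_le_rpow_of_exponent_ge' (by positivity) h8 hck (by nlinarith)
          _ ≤ _ := Real.rpow_le_rpow (by positivity) (by gcongr; linarith) hck
      · have h1 := rpow_exp_neg_le hγ hc₂γ hexp0 hexp hq64 k
        have h2 : -c₂ * k * t ^ 2 * Real.exp (c₂ * r ^ 2 * n) =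
            -(k * (c₂ * (t ^ 2 * Real.exp (c₂ * r ^ 2 * n)))) := by ring
        rw [h2]
        exact mul_le_mul (by linarith) h1 (by positivity) (by positivity)
    · have h1 : 1 ≤ ((8 + 14 / γ) * p) ^ (c₂ * (k : ℝ)) :=
        Real.one_le_rpow (by nlinarith) hck
      have h2 : 0 ≤ (8 + 14 / γ) * Real.exp (-c₂ * k * t ^ 2 * Real.exp (c₂ * r ^ 2 * n)) := by
        positivity
      exact measureReal_le_one.trans (by linarith)
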